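/- Let $k$ be a field and let $\mathcal{T}$ be a saturated (i.e. smooth and proper) $k$-linear triangulated category; this means that $\mathcal{T}$ is idempotent complete and admits a dg enhancement $\mathcal{A}$ which is smooth (the diagonal $\mathcal{A}$-bimodule is perfect) and proper (the total cohomology of every complex $\mathcal{A}(x,y)$ is finite-dimensional over $k$). Let $\mathbb{S}_{\mathcal{T}}$ denote the Serre functor of $\mathcal{T}$. A polarization of index $m>0$ of $\mathcal{T}$ is a $k$-linear exact autoequivalence $\tau\colon\mathcal{T}\to\mathcal{T}$ such that $\tau^m\cong\mathbb{S}_{\mathcal{T}}^{-1}[s]$ (isomorphism of functors) for some integer $s$. Let $\tau$ be a polarization of index $m$ of $\mathcal{T}$, and let $\mathfrak{a}\subset\mathcal{T}$ be a primitive subcategory with respect to $\tau$, i.e. a full triangulated subcategory whose inclusion functor has both a left and a right adjoint (an admissible subcategory) and such that the collection $(\mathfrak{a},\tau(\mathfrak{a}),\dots,\tau^{m-1}(\mathfrak{a}))$ is semiorthogonal: $\operatorname{Hom}(\tau^j(A),\tau^i(B))=0$ for all $A,B\in\mathfrak{a}$ and $0\le i<j\le m-1$. Let $$\mathcal{R}=\langle\mathfrak{a},\tau(\mathfrak{a}),\dots,\tau^{m-1}(\mathfrak{a})\rangle^{\perp}=\{F\in\mathcal{T}\mid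 \operatorname{Hom}(G,F)=0\text{ for all }G\in\langle\mathfrak{a},\tau(\mathfrak{a}),\dots,\tau^{m-1}(\mathfrak{a})\rangle\}$$ be the residual category, where $\langle-\rangle$ denotes the smallest full triangulated subcategory containing the given ones, and let $\mathbb{L}_{\mathfrak{a}}\colon\mathcal{T}\to\mathcal{T}$ be the left mutation functor through $\mathfrak{a}$, defined by the functorial distinguished triangles $\alpha\alpha^!F\to F\to\mathbb{L}_{\mathfrak{a}}(F)\to\alpha\alpha^!F[1]$, where $\alpha\colon\mathfrak{a}\to\mathcal{T}$ is the inclusion and $\alpha^!$ is its right adjoint. Then $\mathcal{R}$ is saturated, the functor $\tau_{\mathcal{R}}:=\mathbb{L}_{\mathfrak{a}}\circ\tau$ maps $\mathcal{R}$ to $\mathcal{R}$ and gives a $k$-linear exact autoequivalence of $\mathcal{R}$, and $\tau_{\mathcal{R}}$ is a polarization of index $m$ of $\mathcal{R}$; that is, $\mathcal{R}$ has a Serre functor $\mathbb{S}_{\mathcal{R}}$ and $\tau_{\mathcal{R}}^m\cong\mathbb{S}_{\mathcal{R}}^{-1}[s']$ for some integer $s'$. -/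

import Mathlib

open CategoryTheory

universe w u v

namespace ResidualCategory

section DG

/-! ### Differential graded categories and bimodules over a field

Complexes are cohomologically graded. Composition is written in the classical order:
`comp g f` is `g ∘ f`. -/

/-- A small differential graded category over `k`. -/
structure DGCategory (k : Type w) [Field k] where
  /-- the objects -/
  Obj : Type v
  /-- the complexes of morphisms -/
  Hom : Obj → Obj → CochainComplex (ModuleCat.{v} k) ℤ
  /-- the composition `g ∘ f` of `g` of degree `q` and `f` of degree `p` -/
  comp : ∀ {x y z : Obj} {q p n : ℤ}, q + p = n →
    ((Hom y z).X q →ₗ[k] (Hom x y).X p →ₗ[k] (Hom x z).X n)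
  /-- the identities -/
  one : ∀ x : Obj, (Hom x x).X 0
  d_one : ∀ x : Obj, ((Hom x x).d 0 1).hom (one x) = 0
  one_comp : ∀ {x y : Obj} {p : ℤ} (f : (Hom x y).X p), comp (zero_add p) (one y) f = f
  comp_one : ∀ {x y : Obj} {p : ℤ} (f : (Hom x y).X p), comp (add_zero p) f (one x) = f
  assoc : ∀ {x y z t : Obj} {r q p rq qp n : ℤ} (hrq : r + q = rq) (hqp : q + p = qp)
    (h₁ : rq + p = n) (h₂ : r + qp = n)
    (h : (Hom z t).X r) (g : (Hom y z).X q) (f : (Hom x y).X p),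
    comp h₁ (comp hrq h g) f = comp h₂ h (comp hqp g f)
  leibniz : ∀ {x y z : Obj} {q p n : ℤ} (h : q + p = n)
    (g : (Hom y z).X q) (f : (Hom x y).X p),
    ((Hom x z).d n (n + 1)).hom (comp h g f) =
      comp (by omega) (((Hom y z).d q (q + 1)).hom g) f +
        q.negOnePow • comp (by omega) g (((Hom x y).d p (p + 1)).hom f)

variable {k : Type w} [Field k]

/-- A dg bimodule over a dg category `A`: contravariant in the first variable, covariant in
the second one. -/
structure DGBimodule (A : DGCategory.{w, v} k) where
  /-- the underlying complexes -/
  M : A.Obj → A.Obj → CochainComplex (ModuleCat.{v} k) ℤ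
  /-- the left action `g · m` -/
  lsmul : ∀ {x y z : A.Obj} {q p n : ℤ}, q + p = n →
    ((A.Hom y z).X q →ₗ[k] (M x y).X p →ₗ[k] (M x z).X n)
  /-- the right action `m · f` -/
  rsmul : ∀ {x y z : A.Obj} {q p n : ℤ}, q + p = n →
    ((M y z).X q →ₗ[k] (A.Hom x y).X p →ₗ[k] (M x z).X n)
  one_lsmul : ∀ {x y : A.Obj} {p : ℤ} (m : (M x y).X p), lsmul (zero_add p) (A.one y) m = m
  rsmul_one : ∀ {x y : A.Obj} {p : ℤ} (m : (M x y).X p), rsmul (add_zero p) m (A.one x) = m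
  comp_lsmul : ∀ {x y z t : A.Obj} {r q p rq qp n : ℤ} (hrq : r + q = rq) (hqp : q + p = qp)
    (h₁ : rq + p = n) (h₂ : r + qp = n)
    (h : (A.Hom z t).X r) (g : (A.Hom y z).X q) (m : (M x y).X p),
    lsmul h₁ (A.comp hrq h g) m = lsmul h₂ h (lsmul hqp g m)
  rsmul_comp : ∀ {x y z t : A.Obj} {r q p rq qp n : ℤ} (hrq : r + q = rq) (hqp : q + p = qp)
    (h₁ : rq + p = n) (h₂ : r + qp = n)
    (m : (M z t).X r) (g : (A.Hom y z).X q) (f : (A.Hom x y).X p),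
    rsmul h₁ (rsmul hrq m g) f = rsmul h₂ m (A.comp hqp g f)
  lsmul_rsmul : ∀ {x y z t : A.Obj} {r q p rq qp n : ℤ} (hrq : r + q = rq) (hqp : q + p = qp)
    (h₁ : rq + p = n) (h₂ : r + qp = n)
    (g : (A.Hom z t).X r) (m : (M y z).X q) (f : (A.Hom x y).X p),
    rsmul h₁ (lsmul hrq g m) f = lsmul h₂ g (rsmul hqp m f)
  d_lsmul : ∀ {x y z : A.Obj} {q p n : ℤ} (h : q + p = n)
    (g : (A.Hom y z).X q) (m : (M x y).X p),
    ((M x z).d n (n + 1)).hom (lsmul h g m) =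
      lsmul (by omega) (((A.Hom y z).d q (q + 1)).hom g) m +
        q.negOnePow • lsmul (by omega) g (((M x y).d p (p + 1)).hom m)
  d_rsmul : ∀ {x y z : A.Obj} {q p n : ℤ} (h : q + p = n)
    (m : (M y z).X q) (f : (A.Hom x y).X p),
    ((M x z).d n (n + 1)).hom (rsmul h m f) =
      rsmul (by omega) (((M y z).d q (q + 1)).hom m) f +
        q.negOnePow • rsmul (by omega) m (((A.Hom x y).d p (p + 1)).hom f)

/-- The diagonal bimodule of a dg category. -/
def DGCategory.diagonal (A : DGCategory.{w, v} k) : DGBimodule A where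
  M := A.Hom
  lsmul h := A.comp h
  rsmul h := A.comp h
  one_lsmul := A.one_comp
  rsmul_one := A.comp_one
  comp_lsmul := A.assoc
  rsmul_comp := A.assoc
  lsmul_rsmul := A.assoc
  d_lsmul := A.leibniz
  d_rsmul := A.leibniz

namespace DGBimodule

variable {A : DGCategory.{w, v} k}

/-- Closed morphisms of degree `0` of dg bimodules. -/
structure Morphism (M N : DGBimodule A) where
  /-- the underlying morphisms of complexes -/
  app : ∀ x y : A.Obj, M.M x y ⟶ N.M x y
  map_lsmul : ∀ {x y z : A.Obj} {q p n : ℤ} (h : q + p = n)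
    (g : (A.Hom y z).X q) (m : (M.M x y).X p),
    ((app x z).f n).hom (M.lsmul h g m) = N.lsmul h g (((app x y).f p).hom m)
  map_rsmul : ∀ {x y z : A.Obj} {q p n : ℤ} (h : q + p = n)
    (m : (M.M y z).X q) (f : (A.Hom x y).X p),
    ((app x z).f n).hom (M.rsmul h m f) = N.rsmul h (((app y z).f q).hom m) f

/-- `P` is free on one closed generator `e ∈ P(a, b)` of degree `0`: the maps `g ⊗ f ↦ g · e · f`
form an isomorphism from `A(b, y) ⊗ A(x, a)` to `P(x, y)`. Thus `P` is the representable
bimodule attached to `(a, b)`. -/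
def IsRepresentable (P : DGBimodule A) (a b : A.Obj) : Prop :=
  ∃ e : (P.M a b).X 0, ((P.M a b).d 0 1).hom e = 0 ∧
    ∀ (x y : A.Obj) (n : ℤ), Function.Bijective
      (DirectSum.toModule k ℤ ((P.M x y).X n) fun q =>
        TensorProduct.lift
          ((P.rsmul (add_sub_cancel q n)).comp ((P.lsmul (add_zero q)).flip e) :
            (A.Hom b y).X q →ₗ[k] (A.Hom x a).X (n - q) →ₗ[k] (P.M x y).X n))

/-- A morphism of dg bimodules that is a quasi-isomorphism. -/
def Morphism.IsQuasiIso {M N : DGBimodule A} (φ : Morphism M N) : Prop :=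
  ∀ x y : A.Obj, QuasiIso (φ.app x y)

/-- `0 → L → M → N → 0` is exact. -/
def IsShortExact {L M N : DGBimodule A} (φ : Morphism L M) (ψ : Morphism M N) : Prop :=
  ∀ (x y : A.Obj) (n : ℤ), Function.Injective ((φ.app x y).f n).hom ∧
    Function.Exact ((φ.app x y).f n).hom ((ψ.app x y).f n).hom ∧
    Function.Surjective ((ψ.app x y).f n).hom

/-- Perfect dg bimodules: those whose image in the derived category lies in the thick triangulated
subcategory generated by the representable ones. Triangles of the derived category are, up to
quasi-isomorphism, short exact sequences; shifts and mapping cones are obtained from these. -/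
inductive IsPerfect : DGBimodule A → Prop
  | representable (P : DGBimodule A) (a b : A.Obj) (h : P.IsRepresentable a b) : IsPerfect P
  | zero (M : DGBimodule A) (h : ∀ (x y : A.Obj) (n : ℤ), Subsingleton ((M.M x y).X n)) :
      IsPerfect M
  | of_quasiIso {M N : DGBimodule A} (φ : Morphism M N) (hφ : φ.IsQuasiIso) (h : IsPerfect M) :
      IsPerfect N
  | of_quasiIso_symm {M N : DGBimodule A} (φ : Morphism M N) (hφ : φ.IsQuasiIso)
      (h : IsPerfect N) : IsPerfect M
  | left {L M N : DGBimodule A} (φ : Morphism L M) (ψ : Morphism M N) (h : IsShortExact φ ψ)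
      (hM : IsPerfect M) (hN : IsPerfect N) : IsPerfect L
  | middle {L M N : DGBimodule A} (φ : Morphism L M) (ψ : Morphism M N) (h : IsShortExact φ ψ)
      (hL : IsPerfect L) (hN : IsPerfect N) : IsPerfect M
  | right {L M N : DGBimodule A} (φ : Morphism L M) (ψ : Morphism M N) (h : IsShortExact φ ψ)
      (hL : IsPerfect L) (hM : IsPerfect M) : IsPerfect N
  | retract {M N : DGBimodule A} (i : Morphism N M) (r : Morphism M N)
      (h : ∀ x y : A.Obj, i.app x y ≫ r.app x y = 𝟙 (N.M x y)) (hM : IsPerfect M) : IsPerfect N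

end DGBimodule

namespace DGCategory

variable (A : DGCategory.{w, v} k)

/-- A dg category is smooth if its diagonal bimodule is perfect. -/
def IsSmooth : Prop := A.diagonal.IsPerfect

/-- A dg category is proper if the total cohomology of each complex of morphisms is
finite-dimensional. -/
def IsProper : Prop :=
  ∀ x y : A.Obj, (∀ n : ℤ, Module.Finite k ((A.Hom x y).homology n)) ∧
    {n : ℤ | ¬ Subsingleton ((A.Hom x y).homology n)}.Finite

/-- The cocycles of degree `n`. -/
abbrev Z (x y : A.Obj) (n : ℤ) : Submodule k ((A.Hom x y).X n) :=
  LinearMap.ker ((A.Hom x y).d n (n + 1)).hom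

variable {A}

/-- `y` is a shift of `x`: there is a closed isomorphism `x → y` of degree `n`. -/
def IsShift (n : ℤ) (x y : A.Obj) : Prop :=
  ∃ (σ : A.Z x y n) (σ' : A.Z y x (-n)),
    A.comp (neg_add_cancel n) σ'.1 σ.1 = A.one x ∧ A.comp (add_neg_cancel n) σ.1 σ'.1 = A.one y

/-- `c` is the cone of the closed morphism `f : x → y` of degree `0`: as a graded object it is
the direct sum of `x[1]` (inclusion `j`, projection `p`) and `y` (inclusion `i`, projection `s`),
with the differential twisted by `f`. -/
structure IsCone {x y c : A.Obj} (f : A.Z x y 0) (i : A.Z y c 0) (p : A.Z c x 1)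
    (j : (A.Hom x c).X (-1)) (s : (A.Hom c y).X 0) : Prop where
  p_j : A.comp (add_neg_cancel 1) p.1 j = A.one x
  s_i : A.comp (add_zero 0) s i.1 = A.one y
  p_i : A.comp (add_zero 1) p.1 i.1 = 0
  s_j : A.comp (zero_add (-1)) s j = 0
  total : A.comp (neg_add_cancel 1) j p.1 + A.comp (add_zero 0) i.1 s = A.one c
  d_j : ((A.Hom x c).d (-1) 0).hom j = A.comp (add_zero 0) i.1 f.1

end DGCategory

end DG

section Triangulated

open Limits Pretriangulated

variable (k : Type w) [Field k]
variable (T : Type u) [Category.{v} T] [Preadditive T] [Linear k T] [HasZeroObject T]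
  [HasShift T ℤ] [∀ n : ℤ, (shiftFunctor T n).Additive] [Pretriangulated T]

/-- A dg enhancement of the `k`-linear triangulated category `T`: a dg category `A` which is closed
under shifts and cones, together with an exact equivalence from its homotopy category to `T`. The
equivalence is given on objects by `obj`, and on morphisms by isomorphisms
`Hⁿ(A(x, y)) ≅ Hom(obj x, (obj y)[n])` for all `n`, compatible with units and compositions. -/
structure DGEnhancement where
  /-- the dg category -/
  A : DGCategory.{w, v} k
  /-- the equivalence, on objects -/
  obj : A.Obj → T
  essSurj : ∀ X : T, ∃ x : A.Obj, Nonempty (obj x ≅ X)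
  /-- the equivalence, on cocycles -/
  map : ∀ {x y : A.Obj} (n : ℤ), A.Z x y n →ₗ[k] ShiftedHom (obj x) (obj y) n
  map_surjective : ∀ {x y : A.Obj} (n : ℤ), Function.Surjective (map n : A.Z x y n → _)
  map_eq_zero_iff : ∀ {x y : A.Obj} (n : ℤ) (f : A.Z x y n),
    map n f = 0 ↔ ∃ g : (A.Hom x y).X (n - 1), ((A.Hom x y).d (n - 1) n).hom g = f.1
  map_one : ∀ (x : A.Obj) (e : A.Z x x 0), e.1 = A.one x →
    map 0 e = ShiftedHom.mk₀ 0 rfl (𝟙 (obj x))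
  map_comp : ∀ {x y z : A.Obj} {q p n : ℤ} (h : q + p = n)
    (g : A.Z y z q) (f : A.Z x y p) (gf : A.Z x z n), gf.1 = A.comp h g.1 f.1 →
    map n gf = (map p f).comp (map q g) h
  exists_shift : ∀ (x : A.Obj) (n : ℤ), ∃ y : A.Obj, DGCategory.IsShift n x y
  exists_cone : ∀ {x y : A.Obj} (f : A.Z x y 0), ∃ (c : A.Obj) (i : A.Z y c 0) (p : A.Z c x 1)
    (j : (A.Hom x c).X (-1)) (s : (A.Hom c y).X 0), DGCategory.IsCone f i p j s
  distinguished : ∀ {x y c : A.Obj} (f : A.Z x y 0) (i : A.Z y c 0) (p : A.Z c x 1)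
    (j : (A.Hom x c).X (-1)) (s : (A.Hom c y).X 0), DGCategory.IsCone f i p j s →
    Triangle.mk ((ShiftedHom.homEquiv 0 rfl).symm (map 0 f))
      ((ShiftedHom.homEquiv 0 rfl).symm (map 0 i)) (map 1 p) ∈ distTriang T

/-- A saturated, that is smooth and proper, triangulated category over `k`: it is idempotent
complete and has a smooth and proper dg enhancement. -/
def IsSaturated : Prop :=
  IsIdempotentComplete T ∧ ∃ E : DGEnhancement k T, E.A.IsSmooth ∧ E.A.IsProper

end Triangulated

section Serre

variable (k : Type w) [Field k]
variable (T : Type u) [Category.{v} T] [Preadditive T] [Linear k T]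

/-- A Serre functor: an autoequivalence `S` with isomorphisms `Hom(X, Y) ≅ Hom(Y, S X)ᵛ`
which are natural in `X` and `Y`. -/
structure SerreFunctor where
  /-- the autoequivalence -/
  S : T ≌ T
  /-- the duality isomorphisms -/
  duality : ∀ X Y : T, (X ⟶ Y) ≃ₗ[k] Module.Dual k (Y ⟶ S.functor.obj X)
  naturality_right : ∀ {X Y Y' : T} (f : X ⟶ Y) (h : Y ⟶ Y') (g : Y' ⟶ S.functor.obj X),
    duality X Y' (f ≫ h) g = duality X Y f (h ≫ g)
  naturality_left : ∀ {X' X Y : T} (h : X' ⟶ X) (f : X ⟶ Y) (g : Y ⟶ S.functor.obj X'),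
    duality X' Y (h ≫ f) g = duality X Y f (g ≫ S.functor.map h)

/-- The iterates `τⁿ` of an endofunctor. -/
def iterate {T : Type u} [Category.{v} T] (τ : T ⥤ T) : ℕ → (T ⥤ T)
  | 0 => 𝟭 T
  | n + 1 => iterate τ n ⋙ τ

end Serre

section Polarization

open Limits Pretriangulated

variable (k : Type w) [Field k]
variable {T : Type u} [Category.{v} T] [Preadditive T] [Linear k T] [HasZeroObject T]
  [HasShift T ℤ] [∀ n : ℤ, (shiftFunctor T n).Additive] [Pretriangulated T]

/-- An autoequivalence of the `k`-linear triangulated category `T`: a `k`-linear exact functor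
which is an equivalence of categories. -/
structure IsTriangulatedAutoequivalence (τ : T ⥤ T) : Prop where
  isEquivalence : τ.IsEquivalence
  linear : τ.Linear k
  exact : ∃ _ : τ.CommShift ℤ, τ.IsTriangulated

/-- `τ` is a polarization of `T` of index `m`: `m > 0`, `τ` is an autoequivalence, and
`τᵐ ≅ S⁻¹[s]` for the Serre functor `S` of `T` and some integer `s`. -/
structure IsPolarization (τ : T ⥤ T) (m : ℕ) : Prop where
  pos : 0 < m
  autoequivalence : IsTriangulatedAutoequivalence k τ
  exists_iso : ∃ (S : SerreFunctor k T) (s : ℤ),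
    Nonempty (iterate τ m ≅ S.S.inverse ⋙ shiftFunctor T s)

end Polarization

section Subcategories

open Limits Pretriangulated

variable {T : Type u} [Category.{v} T] [Preadditive T] [HasZeroObject T]
  [HasShift T ℤ] [∀ n : ℤ, (shiftFunctor T n).Additive] [Pretriangulated T]

/-- A full triangulated subcategory is admissible if its inclusion functor has a left and a
right adjoint. -/
class IsAdmissible (a : ObjectProperty T) : Prop where
  isTriangulated : a.IsTriangulated
  /-- the inclusion functor has a right adjoint -/
  isLeftAdjoint : a.ι.IsLeftAdjoint
  /-- the inclusion functor has a left adjoint -/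
  isRightAdjoint : a.ι.IsRightAdjoint

attribute [instance] IsAdmissible.isTriangulated IsAdmissible.isLeftAdjoint
  IsAdmissible.isRightAdjoint

/-- The collection `(A₀, …, A_{n-1})` is semiorthogonal: there are no nonzero morphisms from
`A_j` to `A_i` for `j > i`. -/
def IsSemiorthogonal {n : ℕ} (A : Fin n → ObjectProperty T) : Prop :=
  ∀ i j : Fin n, i < j → ∀ X Y : T, A j X → A i Y → ∀ f : X ⟶ Y, f = 0

/-- The admissible subcategory `a` is primitive with respect to `τ` (of index `m`):
the collection `(a, τ(a), …, τ^{m-1}(a))` is semiorthogonal. -/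
structure IsPrimitive (τ : T ⥤ T) (m : ℕ) (a : ObjectProperty T) : Prop where
  isAdmissible : IsAdmissible a
  isSemiorthogonal : IsSemiorthogonal fun i : Fin m => a.map (iterate τ i)

/-- The smallest strictly full triangulated subcategory containing the given objects. -/
def triangulatedHull (P : ObjectProperty T) : ObjectProperty T := fun X =>
  ∀ Q : ObjectProperty T, Q.IsTriangulated → Q.IsClosedUnderIsomorphisms → P ≤ Q → Q X

instance (P : ObjectProperty T) : (triangulatedHull P).IsClosedUnderIsomorphisms where
  of_iso e hX Q h₁ h₂ h₃ := Q.prop_of_iso e (hX Q h₁ h₂ h₃)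

instance (P : ObjectProperty T) : (triangulatedHull P).IsTriangulated where
  exists_zero := ⟨_, isZero_zero T, fun Q _ _ _ => Q.prop_zero⟩
  isStableUnderShiftBy n := ⟨fun X hX Q h₁ h₂ h₃ => Q.le_shift n X (hX Q h₁ h₂ h₃)⟩
  toIsTriangulatedClosed₂ := .mk' fun D hD hX hY Q h₁ h₂ h₃ =>
    Q.ext_of_isTriangulatedClosed₂ D hD (hX Q h₁ h₂ h₃) (hY Q h₁ h₂ h₃)

/-- The residual category `⟨a, τ(a), …, τ^{m-1}(a)⟩^⊥`, the full subcategory of all objects `F`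
such that `Hom(G, F) = 0` for all `G ∈ ⟨a, τ(a), …, τ^{m-1}(a)⟩`. -/
abbrev residual (τ : T ⥤ T) (m : ℕ) (a : ObjectProperty T) : ObjectProperty T :=
  (triangulatedHull (⨆ i : Fin m, a.map (iterate τ i))).rightOrthogonal

end Subcategories

section Mutation

/-! ### Left mutation functors

`L_a(X)` is the cone of the counit `α α^! X → X`, where `α^!` is the right adjoint of the
inclusion `α` of `a`. -/

open Limits Pretriangulated

variable {T : Type u} [Category.{v} T] [Preadditive T] [HasZeroObject T]
  [HasShift T ℤ] [∀ n : ℤ, (shiftFunctor T n).Additive] [Pretriangulated T]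
  (a : ObjectProperty T) [IsAdmissible a]

namespace LeftMutation

/-- The adjunction between the inclusion `α` of `a` and its right adjoint `α^!`. -/
noncomputable abbrev adj : a.ι ⊣ a.ι.rightAdjoint := Adjunction.ofIsLeftAdjoint a.ι

/-- The object `α α^! X`. -/
noncomputable abbrev proj (X : T) : T := a.ι.obj (a.ι.rightAdjoint.obj X)

/-- The counit `α α^! X → X`. -/
noncomputable abbrev counit (X : T) : proj a X ⟶ X := (adj a).counit.app X

/-- The object `L_a(X)`. -/
noncomputable def obj (X : T) : T := (distinguished_cocone_triangle (counit a X)).choose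

/-- The morphism `X → L_a(X)`. -/
noncomputable def unit (X : T) : X ⟶ obj a X :=
  (distinguished_cocone_triangle (counit a X)).choose_spec.choose

/-- The morphism `L_a(X) → (α α^! X)[1]`. -/
noncomputable def δ (X : T) : obj a X ⟶ (proj a X)⟦(1 : ℤ)⟧ :=
  (distinguished_cocone_triangle (counit a X)).choose_spec.choose_spec.choose

lemma distinguished (X : T) : Triangle.mk (counit a X) (unit a X) (δ a X) ∈ distTriang T :=
  (distinguished_cocone_triangle (counit a X)).choose_spec.choose_spec.choose_spec

lemma exists_fac (X : T) {A : T} (hA : a A) (g : A ⟶ X) :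
    ∃ h : A ⟶ proj a X, h ≫ counit a X = g := by
  let A' : a.FullSubcategory := ⟨A, hA⟩
  let g' : a.ι.obj A' ⟶ X := g
  have : a.ι.map ((adj a).homEquiv A' X g') ≫ (adj a).counit.app X = g' :=
    ((adj a).homEquiv_counit A' X _).symm.trans (((adj a).homEquiv A' X).symm_apply_apply g')
  exact ⟨_, this⟩

lemma eq_zero_of_counit (X : T) {A : T} (hA : a A) (h : A ⟶ proj a X)
    (w : h ≫ counit a X = 0) : h = 0 := by
  let A' : a.FullSubcategory := ⟨A, hA⟩
  let h' : a.ι.obj A' ⟶ a.ι.obj (a.ι.rightAdjoint.obj X) := h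
  obtain ⟨g, hg⟩ := a.ι.map_surjective h'
  have h₁ : ((adj a).homEquiv A' X).symm g = 0 := by
    rw [Adjunction.homEquiv_counit, hg]
    exact w
  have h₂ : ((adj a).homEquiv A' X).symm 0 = 0 := by
    rw [Adjunction.homEquiv_counit, Functor.map_zero, zero_comp]
  have h₃ : g = 0 := ((adj a).homEquiv A' X).symm.injective (h₁.trans h₂.symm)
  have h₄ : h' = 0 := by rw [← hg, h₃, Functor.map_zero]
  exact h₄

lemma counit_unit (X : T) : counit a X ≫ unit a X = 0 :=
  comp_distTriang_mor_zero₁₂ _ (distinguished a X)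

lemma δ_counit (X : T) : δ a X ≫ (counit a X)⟦(1 : ℤ)⟧' = 0 :=
  comp_distTriang_mor_zero₃₁ _ (distinguished a X)

lemma rightOrthogonal_obj (X : T) : a.rightOrthogonal (obj a X) := by
  intro A f hA
  have hδ : f ≫ δ a X = 0 := by
    let e : (A⟦(-1 : ℤ)⟧)⟦(1 : ℤ)⟧ ≅ A := shiftNegShift A (1 : ℤ)
    obtain ⟨g, hg⟩ := (shiftFunctor T (1 : ℤ)).map_surjective (e.hom ≫ f ≫ δ a X)
    have hg₀ : g = 0 := by
      refine eq_zero_of_counit a X (a.le_shift (-1 : ℤ) _ hA) g ?_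
      apply (shiftFunctor T (1 : ℤ)).map_injective
      rw [Functor.map_comp, hg, Category.assoc, Category.assoc, δ_counit, comp_zero, comp_zero,
        Functor.map_zero]
    rw [← cancel_epi e.hom, ← hg, hg₀, Functor.map_zero, comp_zero]
  have hex : ∃ g : A ⟶ X, f = g ≫ unit a X :=
    Triangle.coyoneda_exact₃ _ (distinguished a X) f hδ
  obtain ⟨g, rfl⟩ := hex
  obtain ⟨h, rfl⟩ := exists_fac a X hA g
  rw [Category.assoc, counit_unit, comp_zero]

lemma existsUnique_desc {X G : T} (hG : a.rightOrthogonal G) (g : X ⟶ G) :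
    ∃! h : obj a X ⟶ G, unit a X ≫ h = g := by
  have hex : ∃ h : obj a X ⟶ G, g = unit a X ≫ h :=
    Triangle.yoneda_exact₂ _ (distinguished a X) g
      (hG _ (a.ι.rightAdjoint.obj X).property)
  obtain ⟨h, rfl⟩ := hex
  refine ⟨h, rfl, fun h' hh' => sub_eq_zero.1 ?_⟩
  have hex' : ∃ l : (proj a X)⟦(1 : ℤ)⟧ ⟶ G, h' - h = δ a X ≫ l :=
    Triangle.yoneda_exact₃ _ (distinguished a X) (h' - h) 
      ((Preadditive.comp_sub _ _ _).trans (sub_eq_zero.2 hh'))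
  obtain ⟨l, hl⟩ := hex'
  rw [hl, hG l (a.le_shift (1 : ℤ) _ (a.ι.rightAdjoint.obj X).property), comp_zero]

end LeftMutation

open LeftMutation in
/-- The left mutation functor `L_a : T ⥤ T` through `a`. On morphisms it is determined by the
naturality of `X → L_a(X)`. -/
noncomputable def leftMutation : T ⥤ T where
  obj := obj a
  map {X Y} f := (existsUnique_desc a (rightOrthogonal_obj a Y) (f ≫ unit a Y)).choose
  map_id X := by
    have h := existsUnique_desc a (rightOrthogonal_obj a X) (𝟙 X ≫ unit a X)
    exact h.unique h.choose_spec.1 (by simp)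
  map_comp {X Y Z} f g := by
    have h := existsUnique_desc a (rightOrthogonal_obj a Z) ((f ≫ g) ≫ unit a Z)
    refine h.unique h.choose_spec.1 ?_
    have h₁ := (existsUnique_desc a (rightOrthogonal_obj a Y) (f ≫ unit a Y)).choose_spec.1
    have h₂ := (existsUnique_desc a (rightOrthogonal_obj a Z) (g ≫ unit a Z)).choose_spec.1
    dsimp only at h₁ h₂
    rw [reassoc_of% h₁, h₂, Category.assoc]

end Mutation

end ResidualCategory

open CategoryTheory Limits ResidualCategory

/-! Write D = ⟨a, τ(a), …, τ^{m-1}(a)⟩, R = D^⊥ and τ_R = L_a ∘ τ. Peeling off the blocks of D one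
at a time gives, for every object X, a map X → Y with Y ∈ R and a map Y' → X with Y' ∈ ^⊥D, both
with cone in D (`hasReflections_hull`, `hasCoreflections_hull`). The maps X → Y are reflections onto
R. The Serre functor S sends ^⊥D into D^⊥, and this turns the maps Y' → X into coreflections onto R
(`exists_rightOrthogonal_coreflection`).

Polarization. Since X → L_a(X) has cone in a, these maps splice into a natural map τ^n → τ_R^n on R
with cone in ⟨a, …, τ^{n-1}(a)⟩ (`trW_iterateTrans`). For n = m the cone lies in D, which has no
maps to R, so for X, Y in R Hom(τ_R^m(Y)[-s], X) = Hom(τ^m(Y)[-s], X) = Hom(S⁻¹(Y), X) = Hom(Y,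
S(X)). Hence τ_R^m[-s] is left adjoint to the functor S_R taking X to the coreflection of S(X) in R.
S_R inherits the duality of S, and duality alone makes S_R fully faithful and makes any left adjoint
of it reflect isomorphisms. So S_R is a Serre functor with inverse τ_R^m[-s], and τ_R is an
equivalence because its m-th power is one (`IsPrimitive.isPolarization`).

Saturatedness. The full dg subcategory on the objects of R enhances R, and properness is inherited.
For smoothness the diagonal bimodule is restricted. A representable bimodule A(b, -) ⊗ A(-, a)
restricts to one quasi-isomorphic to A(b', -) ⊗ A(-, a'), where b → b' is the reflection and a' → a
the coreflection onto R. Tensor products over a field preserve quasi-isomorphisms, and restriction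
is exact, so perfect bimodules restrict to perfect ones (`isPerfect_restrict`). -/

namespace ResidualCategory

/-! ### Complexes of vector spaces: contractions and quasi-isomorphisms -/

section Complexes

variable {k : Type w} [Field k]

lemma exists_generalized_inverse {V W : Type*} [AddCommGroup V] [Module k V] [AddCommGroup W]
    [Module k W] (d : V →ₗ[k] W) : ∃ s : W →ₗ[k] V, d ∘ₗ s ∘ₗ d = d := by
  obtain ⟨g, hg⟩ := d.rangeRestrict.exists_rightInverse_of_surjective d.range_rangeRestrict
  obtain ⟨s, hs⟩ := g.exists_extend
  refine ⟨s, LinearMap.ext fun x => ?_⟩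
  have h₁ : s (d x) = g (d.rangeRestrict x) := LinearMap.congr_fun hs (d.rangeRestrict x)
  have h₂ := congrArg Subtype.val (LinearMap.congr_fun hg (d.rangeRestrict x))
  simpa [h₁] using h₂

/-- An acyclic complex of vector spaces is contractible. -/
lemma nonempty_contraction (K : CochainComplex (ModuleCat.{v} k) ℤ) (hK : K.Acyclic) :
    Nonempty (Homotopy (𝟙 K) 0) := by
  have hs : ∀ i j : ℤ, ∃ s : K.X i ⟶ K.X j, K.d j i ≫ s ≫ K.d j i = K.d j i ∧
      (¬ j + 1 = i → s = 0) := fun i j => by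
    by_cases hij : j + 1 = i
    · obtain ⟨s, hs⟩ := exists_generalized_inverse (K.d j i).hom
      exact ⟨ModuleCat.ofHom s, by ext x; exact LinearMap.congr_fun hs x, fun h => (h hij).elim⟩
    · exact ⟨0, by rw [zero_comp, comp_zero, K.shape _ _ hij], fun _ => rfl⟩
  choose s hs hs₀ using hs
  let π : ∀ i, K.X i ⟶ K.X i := fun i => s i (i - 1) ≫ K.d (i - 1) i
  have hdπ : ∀ i j, K.d i j ≫ π j = K.d i j := fun i j => by
    by_cases hij : i + 1 = j
    · obtain rfl : i = j - 1 := by omega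
      exact hs _ _
    · rw [K.shape _ _ hij, zero_comp]
  have hπd : ∀ i j, π i ≫ K.d i j = 0 := fun i j => by simp [π]
  have hππ : ∀ i, π i ≫ π i = π i := fun i => by
    rw [show π i ≫ π i = s i (i - 1) ≫ K.d (i - 1) i ≫ π i by simp [π], hdπ]
  have hπ : ∀ {Z : ModuleCat.{v} k} (i : ℤ) (f : Z ⟶ K.X i), f ≫ K.d i (i + 1) = 0 →
      f ≫ π i = f := fun {Z} i f hf => by
    ext z
    have hex := (HomologicalComplex.exactAt_iff' K (i - 1) i (i + 1) (by simp) (by simp)).1 (hK i)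
    rw [ShortComplex.moduleCat_exact_iff] at hex
    obtain ⟨y, hy⟩ : ∃ y : K.X (i - 1), K.d (i - 1) i y = f z :=
      hex (f z) (ConcreteCategory.congr_hom hf z)
    have : π i (K.d (i - 1) i y) = K.d (i - 1) i y := ConcreteCategory.congr_hom (hdπ (i - 1) i) y
    rw [hy] at this
    exact this
  refine ⟨{
    -- Take the cocycle part, choose a primitive, and remove the cocycle part of the primitive. With
    -- this last correction `d` followed by the homotopy is exactly `𝟙 - π`, which adds up with `π`
    -- to the identity.
    hom := fun i j => π i ≫ s i j ≫ (𝟙 _ - π j)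
    zero := fun i j hij => by
      have : s i j = 0 := hs₀ i j hij
      rw [this, zero_comp, comp_zero]
    comm := fun i => ?_ }⟩
  have hi : (ComplexShape.up ℤ).Rel (i - 1) i := by simp
  rw [dNext_eq _ (show (ComplexShape.up ℤ).Rel i (i + 1) from rfl), prevD_eq _ hi]
  have h₁ : K.d i (i + 1) ≫ π (i + 1) ≫ s (i + 1) i ≫ (𝟙 _ - π i) = 𝟙 _ - π i := by
    rw [reassoc_of% (hdπ i (i + 1))]
    have := hπ i (K.d i (i + 1) ≫ s (i + 1) i - 𝟙 _) (by
      rw [Preadditive.sub_comp, Category.assoc, hs, Category.id_comp, sub_self])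
    rw [Preadditive.comp_sub, Preadditive.comp_sub, Category.comp_id]
    rw [Preadditive.sub_comp, Category.id_comp, Category.assoc] at this
    rw [← sub_eq_zero]
    rw [← sub_eq_zero] at this
    rw [← neg_eq_zero, ← this]
    abel
  have h₂ : (π i ≫ s i (i - 1) ≫ (𝟙 _ - π (i - 1))) ≫ K.d (i - 1) i = π i := by
    simp only [Category.assoc, Preadditive.sub_comp, Category.id_comp, hπd, sub_zero]
    exact hππ i
  rw [h₁, h₂]
  simp

/-- A map out of an acyclic complex is null-homotopic because its source is already contractible.
This is what makes quasi-isomorphisms over a field homotopy equivalences. -/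
instance isKInjective (K : CochainComplex (ModuleCat.{v} k) ℤ) : K.IsKInjective where
  nonempty_homotopy_zero {L} f hL := by
    obtain ⟨h⟩ := nonempty_contraction L hL
    exact ⟨(Homotopy.ofEq (by simp)).trans ((h.compRight f).trans (Homotopy.ofEq (by simp)))⟩

lemma exists_homotopyEquiv {K L : CochainComplex (ModuleCat.{v} k) ℤ}
    (f : K ⟶ L) (hf : QuasiIso f) :
    ∃ e : HomotopyEquiv K L, e.hom = f :=
  (CochainComplex.IsKInjective.quasiIso_iff f).1 hf

/-- A criterion for quasi-isomorphisms in terms of cocycles. -/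
lemma quasiIso_of_cocycles {K L : CochainComplex (ModuleCat.{v} k) ℤ} (f : K ⟶ L)
    (hinj : ∀ (n : ℤ) (x : K.X n), K.d n (n + 1) x = 0 → ∀ w : L.X (n - 1),
      L.d (n - 1) n w = f.f n x → ∃ z : K.X (n - 1), K.d (n - 1) n z = x)
    (hsurj : ∀ (n : ℤ) (y : L.X n), L.d n (n + 1) y = 0 → ∃ x : K.X n, K.d n (n + 1) x = 0 ∧
      ∃ w : L.X (n - 1), L.d (n - 1) n w = f.f n x - y) : QuasiIso f := by
  have hcyc : ∀ (K : CochainComplex (ModuleCat.{v} k) ℤ) (n : ℤ) (x : K.X n),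
      K.d n (n + 1) x = 0 → ∃ z : K.cycles n, K.iCycles n z = x := fun K n x hx =>
    (ShortComplex.moduleCat_exact_iff _).1 (ShortComplex.exact_of_f_is_kernel
      (ShortComplex.mk (K.iCycles n) (K.d n (n + 1)) (by simp))
      (K.cyclesIsKernel n (n + 1) (by simp))) x hx
  have hbd : ∀ (K : CochainComplex (ModuleCat.{v} k) ℤ) (n : ℤ) (z : K.cycles n),
      K.homologyπ n z = 0 → ∃ y : K.X (n - 1), K.toCycles (n - 1) n y = z := fun K n z hz =>
    (ShortComplex.moduleCat_exact_iff _).1 (ShortComplex.exact_of_g_is_cokernel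
      (ShortComplex.mk (K.toCycles (n - 1) n) (K.homologyπ n) (by simp))
      (K.homologyIsCokernel (n - 1) n (by simp))) z hz
  have hi : ∀ (K : CochainComplex (ModuleCat.{v} k) ℤ) (n : ℤ),
      Function.Injective (K.iCycles n) := fun K n =>
    (ModuleCat.mono_iff_injective _).1 inferInstance
  have hπ : ∀ (K : CochainComplex (ModuleCat.{v} k) ℤ) (n : ℤ),
      Function.Surjective (K.homologyπ n) := fun K n =>
    (ModuleCat.epi_iff_surjective _).1 inferInstance
  have hti : ∀ (K : CochainComplex (ModuleCat.{v} k) ℤ) (n : ℤ) (y : K.X (n - 1)),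
      K.iCycles n (K.toCycles (n - 1) n y) = K.d (n - 1) n y := fun K n y => by
    rw [← ConcreteCategory.comp_apply, K.toCycles_i]
  have hdi : ∀ (K : CochainComplex (ModuleCat.{v} k) ℤ) (n : ℤ) (z : K.cycles n),
      K.d n (n + 1) (K.iCycles n z) = 0 := fun K n z => by
    rw [← ConcreteCategory.comp_apply, K.iCycles_d]; rfl
  have hci : ∀ (n : ℤ) (z : K.cycles n),
      L.iCycles n (HomologicalComplex.cyclesMap f n z) = f.f n (K.iCycles n z) := fun n z => by
    rw [← ConcreteCategory.comp_apply, HomologicalComplex.cyclesMap_i, ConcreteCategory.comp_apply]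
  have htπ : ∀ (K : CochainComplex (ModuleCat.{v} k) ℤ) (n : ℤ) (y : K.X (n - 1)),
      K.homologyπ n (K.toCycles (n - 1) n y) = 0 := fun K n y => by
    rw [← ConcreteCategory.comp_apply, K.toCycles_comp_homologyπ]; rfl
  have hmπ : ∀ (n : ℤ) (z : K.cycles n), HomologicalComplex.homologyMap f n (K.homologyπ n z) =
      L.homologyπ n (HomologicalComplex.cyclesMap f n z) := fun n z => by
    rw [← ConcreteCategory.comp_apply, HomologicalComplex.homologyπ_naturality,
      ConcreteCategory.comp_apply]
  refine ⟨fun n => ?_⟩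
  rw [quasiIsoAt_iff_isIso_homologyMap, ConcreteCategory.isIso_iff_bijective]
  constructor
  · refine (injective_iff_map_eq_zero (HomologicalComplex.homologyMap f n).hom).2 fun α hα => ?_
    obtain ⟨z, rfl⟩ := hπ K n α
    obtain ⟨y, hy⟩ := hbd L n (HomologicalComplex.cyclesMap f n z) ((hmπ n z).symm.trans hα)
    obtain ⟨t, ht⟩ := hinj n (K.iCycles n z) (hdi K n z) y (by rw [← hti, hy, hci])
    rw [← hi K n ((hti K n t).trans ht)]
    exact htπ K n t
  · intro β
    obtain ⟨z, rfl⟩ := hπ L n β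
    obtain ⟨x, hx, y, hy⟩ := hsurj n _ (hdi L n z)
    obtain ⟨t, rfl⟩ := hcyc K n x hx
    refine ⟨K.homologyπ n t, ?_⟩
    rw [hmπ]
    have : HomologicalComplex.cyclesMap f n t = L.toCycles (n - 1) n y + z := by
      apply hi L n
      rw [hci, map_add, hti, hy]
      abel
    rw [this, map_add, htπ, zero_add]

end Complexes

/-! ### The tensor product of complexes of vector spaces -/

namespace Tot

variable {k : Type w} [Field k]

/-- A linear map, as a morphism between bundled modules. -/
abbrev ofLin {M N : ModuleCat.{v} k} (f : M →ₗ[k] N) : M ⟶ N := ModuleCat.ofHom f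

section

variable (K L : CochainComplex (ModuleCat.{v} k) ℤ)

/-- The terms of the tensor product of two complexes. -/
abbrev X (n : ℤ) : Type v := DirectSum ℤ fun q => TensorProduct k (K.X q) (L.X (n - q))

/-- Pure tensors. -/
noncomputable def tmul {q p n : ℤ} (h : q + p = n) : K.X q →ₗ[k] L.X p →ₗ[k] X K L n := by
  obtain rfl : p = n - q := by omega
  exact (TensorProduct.mk k (K.X q) (L.X (n - q))).compr₂
    (DirectSum.lof k ℤ (fun q => TensorProduct k (K.X q) (L.X (n - q))) q)

variable {K L}

/-- Linear maps out of the tensor product. -/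
noncomputable def desc {n : ℤ} {Z : Type*} [AddCommGroup Z] [Module k Z]
    (φ : ∀ q p : ℤ, q + p = n → (K.X q →ₗ[k] L.X p →ₗ[k] Z)) : X K L n →ₗ[k] Z :=
  DirectSum.toModule k ℤ Z fun q => TensorProduct.lift (φ q (n - q) (by omega))

@[simp]
lemma desc_tmul {n : ℤ} {Z : Type*} [AddCommGroup Z] [Module k Z]
    (φ : ∀ q p : ℤ, q + p = n → (K.X q →ₗ[k] L.X p →ₗ[k] Z)) {q p : ℤ} (h : q + p = n)
    (g : K.X q) (f : L.X p) : desc φ (tmul K L h g f) = φ q p h g f := by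
  obtain rfl : p = n - q := by omega
  simp [desc, tmul]

lemma hom_ext {n : ℤ} {Z : Type*} [AddCommGroup Z] [Module k Z] {α β : X K L n →ₗ[k] Z}
    (h : ∀ (q p : ℤ) (h : q + p = n) (g : K.X q) (f : L.X p),
      α (tmul K L h g f) = β (tmul K L h g f)) : α = β := by
  refine DirectSum.linearMap_ext k fun q => TensorProduct.ext' fun g f => ?_
  exact h q (n - q) (by omega) g f

variable (K L)

/-- The differential of the tensor product. -/
noncomputable def d (n n' : ℤ) (hn : n + 1 = n') : X K L n →ₗ[k] X K L n' :=
  desc fun q p h => (tmul K L (show q + 1 + p = n' by omega)).comp (K.d q (q + 1)).hom +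
    q.negOnePow • (tmul K L (show q + (p + 1) = n' by omega)).compl₂ (L.d p (p + 1)).hom

@[simp]
lemma d_tmul {q p n n' : ℤ} (hn : n + 1 = n') (h : q + p = n) (g : K.X q) (f : L.X p) :
    d K L n n' hn (tmul K L h g f) =
      tmul K L (show q + 1 + p = n' by omega) ((K.d q (q + 1)).hom g) f +
        q.negOnePow • tmul K L (show q + (p + 1) = n' by omega) g ((L.d p (p + 1)).hom f) := by
  simp [d]

lemma d_d_apply (K : CochainComplex (ModuleCat.{v} k) ℤ) (i j l : ℤ) (x : K.X i) :
    (K.d j l).hom ((K.d i j).hom x) = 0 := by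
  rw [← LinearMap.comp_apply, ← ModuleCat.hom_comp, K.d_comp_d]
  rfl

/-- The tensor product of two complexes of vector spaces. -/
noncomputable def tot : CochainComplex (ModuleCat.{v} k) ℤ :=
  CochainComplex.of (fun n => ModuleCat.of k (X K L n))
    (fun n => ModuleCat.ofHom (d K L n (n + 1) rfl)) fun n => by
      ext1
      refine hom_ext fun q p h g f => ?_
      simp [Int.negOnePow_succ, d_d_apply]

/-- Pure tensors, as elements of the tensor product complex. -/
noncomputable def mk {q p n : ℤ} (h : q + p = n) : K.X q →ₗ[k] L.X p →ₗ[k] (tot K L).X n :=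
  tmul K L h

variable {K L}

/-- Linear maps out of the terms of the tensor product complex. -/
noncomputable def lift {n : ℤ} {Z : Type*} [AddCommGroup Z] [Module k Z]
    (φ : ∀ q p : ℤ, q + p = n → (K.X q →ₗ[k] L.X p →ₗ[k] Z)) : (tot K L).X n →ₗ[k] Z :=
  desc φ

@[simp]
lemma lift_mk {n : ℤ} {Z : Type*} [AddCommGroup Z] [Module k Z]
    (φ : ∀ q p : ℤ, q + p = n → (K.X q →ₗ[k] L.X p →ₗ[k] Z)) {q p : ℤ} (h : q + p = n)
    (g : K.X q) (f : L.X p) : lift φ (mk K L h g f) = φ q p h g f :=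
  desc_tmul φ h g f

lemma lin_ext {n : ℤ} {Z : Type*} [AddCommGroup Z] [Module k Z] {α β : (tot K L).X n →ₗ[k] Z}
    (h : ∀ (q p : ℤ) (h : q + p = n) (g : K.X q) (f : L.X p),
      α (mk K L h g f) = β (mk K L h g f)) : α = β :=
  hom_ext h

@[simp]
lemma d_mk {q p n n' : ℤ} (hn : n + 1 = n') (h : q + p = n) (g : K.X q) (f : L.X p) :
    ((tot K L).d n n').hom (mk K L h g f) =
      mk K L (show q + 1 + p = n' by omega) ((K.d q (q + 1)).hom g) f +
        q.negOnePow • mk K L (show q + (p + 1) = n' by omega) g ((L.d p (p + 1)).hom f) := by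
  subst hn
  have : (tot K L).d n (n + 1) = ModuleCat.ofHom (d K L n (n + 1) rfl) :=
    CochainComplex.of_d _ (fun n => ModuleCat.ofHom (d K L n (n + 1) rfl)) _
  rw [this]
  exact d_tmul K L rfl h g f

end

section

variable {K K' L L' : CochainComplex (ModuleCat.{v} k) ℤ}

lemma f_d_apply (f : K ⟶ K') (i j : ℤ) (x : K.X i) :
    (f.f j).hom ((K.d i j).hom x) = (K'.d i j).hom ((f.f i).hom x) := by
  rw [← LinearMap.comp_apply, ← ModuleCat.hom_comp, ← f.comm]
  rfl

/-- The morphism of tensor products induced by two morphisms of complexes. -/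
noncomputable def map (f : K ⟶ K') (g : L ⟶ L') : tot K L ⟶ tot K' L' where
  f n := ofLin (lift fun _ _ h => (mk K' L' h).compl₁₂ (f.f _).hom (g.f _).hom)
  comm' i j hij := by
    ext1
    refine lin_ext fun q p h x y => ?_
    obtain rfl : i + 1 = j := hij
    simp [f_d_apply]

lemma map_f_mk (f : K ⟶ K') (g : L ⟶ L') {q p n : ℤ} (h : q + p = n) (x : K.X q) (y : L.X p) :
    ((map f g).f n).hom (mk K L h x y) = mk K' L' h ((f.f q).hom x) ((g.f p).hom y) := by
  simp [map]

lemma map_comp_map {K'' L'' : CochainComplex (ModuleCat.{v} k) ℤ} (f : K ⟶ K') (g : L ⟶ L')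
    (f' : K' ⟶ K'') (g' : L' ⟶ L'') : map f g ≫ map f' g' = map (f ≫ f') (g ≫ g') := by
  ext n : 2
  refine lin_ext fun q p h x y => ?_
  change ((map f' g').f n).hom (((map f g).f n).hom _) = _
  simp [map_f_mk]

lemma map_id : map (𝟙 K) (𝟙 L) = 𝟙 (tot K L) := by
  ext n : 2
  refine lin_ext fun q p h x y => ?_
  change _ = mk K L h x y
  simp [map_f_mk]

lemma homotopy_apply {f f' : K ⟶ K'} (H : Homotopy f f') (n : ℤ) (x : K.X n) :
    (f.f n).hom x = (H.hom (n + 1) n).hom ((K.d n (n + 1)).hom x) +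
      (K'.d (n - 1) n).hom ((H.hom n (n - 1)).hom x) + (f'.f n).hom x := by
  have := H.comm n
  rw [dNext_eq _ (show (ComplexShape.up ℤ).Rel n (n + 1) from rfl),
    prevD_eq _ (show (ComplexShape.up ℤ).Rel (n - 1) n by simp)] at this
  rw [this]
  rfl

lemma mk_congr_left {q q' p n : ℤ} (hq : q = q') (h : q + p = n) (h' : q' + p = n)
    (α : ∀ q, K.X q) (y : L.X p) : mk K L h (α q) y = mk K L h' (α q') y := by
  subst hq
  rfl

lemma mk_congr_right {q p p' n : ℤ} (hp : p = p') (h : q + p = n) (h' : q + p' = n)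
    (x : K.X q) (β : ∀ p, L.X p) : mk K L h x (β p) = mk K L h' x (β p') := by
  subst hp
  rfl

/-- The terms of `homotopyLeft`. -/
noncomputable def homLeft {f f' : K ⟶ K'} (H : Homotopy f f') (g : L ⟶ L') {i j : ℤ}
    (hij : j + 1 = i) : (tot K L).X i →ₗ[k] (tot K' L').X j :=
  lift fun q p h =>
    (mk K' L' (show q - 1 + p = j by omega)).compl₁₂ (H.hom q (q - 1)).hom (g.f p).hom

lemma homLeft_mk {f f' : K ⟶ K'} (H : Homotopy f f') (g : L ⟶ L') {i j : ℤ}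
    (hij : j + 1 = i) {q p : ℤ} (h : q + p = i) (x : K.X q) (y : L.X p) :
    homLeft H g hij (mk K L h x y) =
      mk K' L' (show q - 1 + p = j by omega) ((H.hom q (q - 1)).hom x) ((g.f p).hom y) := by
  simp [homLeft]

/-- A homotopy on the left factor induces a homotopy on the tensor product. -/
noncomputable def homotopyLeft {f f' : K ⟶ K'} (H : Homotopy f f') (g : L ⟶ L') :
    Homotopy (map f g) (map f' g) where
  hom i j := if hij : j + 1 = i then ofLin (homLeft H g hij) else 0
  zero i j hij := dif_neg hij
  comm n := by
    have hn : n - 1 + 1 = n := by omega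
    rw [dNext_eq _ (show (ComplexShape.up ℤ).Rel n (n + 1) from rfl),
      prevD_eq _ (show (ComplexShape.up ℤ).Rel (n - 1) n from hn)]
    simp only [hn, dite_true]
    ext1
    refine lin_ext fun q p h x y => ?_
    change ((map f g).f n).hom _ = homLeft H g rfl (((tot K L).d n (n + 1)).hom _) +
      ((tot K' L').d (n - 1) n).hom (homLeft H g hn _) + ((map f' g).f n).hom _
    simp only [map_f_mk, d_mk rfl, d_mk hn, homLeft_mk, map_add, map_zsmul_unit,
      homotopy_apply H q x, map_add, LinearMap.add_apply, f_d_apply]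
    rw [mk_congr_left (K := K') (L := L') (show q + 1 - 1 = q by omega) _ h
      (fun j => (H.hom (q + 1) j).hom ((K.d q (q + 1)).hom x)),
      mk_congr_left (K := K') (L := L') (show q - 1 + 1 = q by omega) _ h
      (fun j => (K'.d (q - 1) j).hom ((H.hom q (q - 1)).hom x)),
      show (q - 1).negOnePow = -q.negOnePow by simp [Int.negOnePow_sub]]
    simp only [Units.neg_smul]
    abel

/-- The terms of `homotopyRight`. -/
noncomputable def homRight (f : K ⟶ K') {g g' : L ⟶ L'} (H : Homotopy g g') {i j : ℤ}
    (hij : j + 1 = i) : (tot K L).X i →ₗ[k] (tot K' L').X j :=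
  -- Koszul sign for moving a homotopy of degree -1 past an element of degree `q`; it makes the
  -- terms containing the differential of that element cancel.
  lift fun q p h => q.negOnePow •
    (mk K' L' (show q + (p - 1) = j by omega)).compl₁₂ (f.f q).hom (H.hom p (p - 1)).hom

lemma homRight_mk (f : K ⟶ K') {g g' : L ⟶ L'} (H : Homotopy g g') {i j : ℤ}
    (hij : j + 1 = i) {q p : ℤ} (h : q + p = i) (x : K.X q) (y : L.X p) :
    homRight f H hij (mk K L h x y) =
      q.negOnePow •
        mk K' L' (show q + (p - 1) = j by omega) ((f.f q).hom x) ((H.hom p (p - 1)).hom y) := by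
  simp [homRight]

/-- A homotopy on the right factor induces a homotopy on the tensor product. -/
noncomputable def homotopyRight (f : K ⟶ K') {g g' : L ⟶ L'} (H : Homotopy g g') :
    Homotopy (map f g) (map f g') where
  hom i j := if hij : j + 1 = i then ofLin (homRight f H hij) else 0
  zero i j hij := dif_neg hij
  comm n := by
    have hn : n - 1 + 1 = n := by omega
    rw [dNext_eq _ (show (ComplexShape.up ℤ).Rel n (n + 1) from rfl),
      prevD_eq _ (show (ComplexShape.up ℤ).Rel (n - 1) n from hn)]
    simp only [hn, dite_true]
    ext1
    refine lin_ext fun q p h x y => ?_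
    change ((map f g).f n).hom _ = homRight f H rfl (((tot K L).d n (n + 1)).hom _) +
      ((tot K' L').d (n - 1) n).hom (homRight f H hn _) + ((map f g').f n).hom _
    simp only [map_f_mk, d_mk rfl, d_mk hn, homRight_mk, map_add, map_zsmul_unit,
      homotopy_apply H p y, map_add, f_d_apply, smul_add, smul_smul,
      Int.units_mul_self, one_smul]
    rw [mk_congr_right (K := K') (L := L') (show p + 1 - 1 = p by omega) _ h _
      (fun j => (H.hom (p + 1) j).hom ((L.d p (p + 1)).hom y)),
      mk_congr_right (K := K') (L := L') (show p - 1 + 1 = p by omega) _ h _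
      (fun j => (L'.d (p - 1) j).hom ((H.hom p (p - 1)).hom y)), Int.negOnePow_succ]
    simp only [Units.neg_smul]
    abel

/-- Over a field both maps are homotopy equivalences, and homotopies can be tensored with a morphism
on either side. -/
lemma quasiIso_map (f : K ⟶ K') (g : L ⟶ L') (hf : QuasiIso f) (hg : QuasiIso g) :
    QuasiIso (map f g) := by
  obtain ⟨e, rfl⟩ := exists_homotopyEquiv f hf
  obtain ⟨e', rfl⟩ := exists_homotopyEquiv g hg
  let E : HomotopyEquiv (tot K L) (tot K' L') :=
    { hom := map e.hom e'.hom
      inv := map e.inv e'.inv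
      homotopyHomInvId := (Homotopy.ofEq (map_comp_map _ _ _ _)).trans
        ((homotopyLeft e.homotopyHomInvId _).trans ((homotopyRight _ e'.homotopyHomInvId).trans
          (Homotopy.ofEq map_id)))
      homotopyInvHomId := (Homotopy.ofEq (map_comp_map _ _ _ _)).trans
        ((homotopyLeft e.homotopyInvHomId _).trans ((homotopyRight _ e'.homotopyInvHomId).trans
          (Homotopy.ofEq map_id))) }
  exact E.quasiIso_hom

end

end Tot

/-! ### Smoothness of full dg subcategories -/

section DG

variable {k : Type w} [Field k]

namespace DGBimodule

variable {A : DGCategory.{w, v} k}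

section Free

variable (A) (a b : A.Obj)

/-- The left action on the free bimodule. -/
noncomputable def freeLsmul {x y z : A.Obj} {q p n : ℤ} (h : q + p = n) :
    (A.Hom y z).X q →ₗ[k] (Tot.tot (A.Hom b y) (A.Hom x a)).X p →ₗ[k]
      (Tot.tot (A.Hom b z) (A.Hom x a)).X n :=
  (Tot.lift (Z := (A.Hom y z).X q →ₗ[k] (Tot.tot (A.Hom b z) (A.Hom x a)).X n) fun q' p' h' =>
    LinearMap.mk₂ k (fun (g' : (A.Hom b y).X q') (f : (A.Hom x a).X p') =>
      ((Tot.mk (A.Hom b z) (A.Hom x a) (show q + q' + p' = n by omega)).flip f).comp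
        ((A.comp (show q + q' = q + q' from rfl)).flip g'))
      (fun _ _ _ => by ext; simp) (fun _ _ _ => by ext; simp) (fun _ _ _ => by ext; simp)
      (fun _ _ _ => by ext; simp)).flip

/-- The degree `s` of the composite is a free index tied to `q + q'` only by a proposition, so that
degrees can be reassociated without casts. -/
lemma freeLsmul_mk {x y z : A.Obj} {q p n q' p' s : ℤ} (h : q + p = n) (h' : q' + p' = p)
    (hs : q + q' = s) (g : (A.Hom y z).X q) (g' : (A.Hom b y).X q') (f : (A.Hom x a).X p') :
    freeLsmul A a b h g (Tot.mk _ _ h' g' f) =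
      Tot.mk (A.Hom b z) (A.Hom x a) (show s + p' = n by omega) (A.comp hs g g') f := by
  subst hs
  simp [freeLsmul]

/-- The right action on the free bimodule. -/
noncomputable def freeRsmul {x y z : A.Obj} {q p n : ℤ} (h : q + p = n) :
    (Tot.tot (A.Hom b z) (A.Hom y a)).X q →ₗ[k] (A.Hom x y).X p →ₗ[k]
      (Tot.tot (A.Hom b z) (A.Hom x a)).X n :=
  Tot.lift (Z := (A.Hom x y).X p →ₗ[k] (Tot.tot (A.Hom b z) (A.Hom x a)).X n) fun q' p' h' =>
    LinearMap.mk₂ k (fun (g : (A.Hom b z).X q') (f : (A.Hom y a).X p') =>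
      (Tot.mk (A.Hom b z) (A.Hom x a) (show q' + (p' + p) = n by omega) g).comp
        (A.comp (show p' + p = p' + p from rfl) f))
      (fun _ _ _ => by ext; simp) (fun _ _ _ => by ext; simp) (fun _ _ _ => by ext; simp)
      (fun _ _ _ => by ext; simp)

lemma freeRsmul_mk {x y z : A.Obj} {q p n q' p' s : ℤ} (h : q + p = n) (h' : q' + p' = q)
    (hs : p' + p = s) (g : (A.Hom b z).X q') (f : (A.Hom y a).X p') (f' : (A.Hom x y).X p) :
    freeRsmul A a b h (Tot.mk _ _ h' g f) f' =
      Tot.mk (A.Hom b z) (A.Hom x a) (show q' + s = n by omega) g (A.comp hs f f') := by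
  subst hs
  simp [freeRsmul]

/-- The free bimodule on one closed generator of degree `0` in `(a, b)`. -/
noncomputable def free : DGBimodule A where
  M x y := Tot.tot (A.Hom b y) (A.Hom x a)
  lsmul h := freeLsmul A a b h
  rsmul h := freeRsmul A a b h
  one_lsmul {x y p} m := by
    refine LinearMap.congr_fun (f := freeLsmul A a b (zero_add p) (A.one y))
      (g := LinearMap.id) (Tot.lin_ext fun q p h g f => ?_) m
    rw [freeLsmul_mk A a b _ h (zero_add q), A.one_comp]
    rfl
  rsmul_one {x y p} m := by
    refine LinearMap.congr_fun (f := (freeRsmul A a b (add_zero p)).flip (A.one x))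
      (g := LinearMap.id) (Tot.lin_ext fun q p h g f => ?_) m
    rw [LinearMap.flip_apply, freeRsmul_mk A a b _ h (add_zero p), A.comp_one]
    rfl
  comp_lsmul {x y z t r q p rq qp n} hrq hqp h₁ h₂ h g m := by
    refine LinearMap.congr_fun (f := freeLsmul A a b h₁ (A.comp hrq h g))
      (g := (freeLsmul A a b h₂ h).comp (freeLsmul A a b hqp g))
      (Tot.lin_ext fun q' p' h' g' f => ?_) m
    rw [LinearMap.comp_apply, freeLsmul_mk A a b h₁ h' rfl, freeLsmul_mk A a b hqp h' rfl,
      freeLsmul_mk A a b h₂ _ (show r + (q + q') = rq + q' by omega), A.assoc]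
  rsmul_comp {x y z t r q p rq qp n} hrq hqp h₁ h₂ m g f := by
    refine LinearMap.congr_fun
      (f := ((freeRsmul A a b h₁).flip f).comp ((freeRsmul A a b hrq).flip g))
      (g := (freeRsmul A a b h₂).flip (A.comp hqp g f))
      (Tot.lin_ext fun q' p' h' g' f' => ?_) m
    rw [LinearMap.comp_apply, LinearMap.flip_apply, LinearMap.flip_apply, LinearMap.flip_apply,
      freeRsmul_mk A a b hrq h' rfl, freeRsmul_mk A a b h₂ h' rfl,
      freeRsmul_mk A a b h₁ _ (show p' + q + p = p' + qp by omega), A.assoc]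
  lsmul_rsmul {x y z t r q p rq qp n} hrq hqp h₁ h₂ g m f := by
    refine LinearMap.congr_fun
      (f := ((freeRsmul A a b h₁).flip f).comp (freeLsmul A a b hrq g))
      (g := (freeLsmul A a b h₂ g).comp ((freeRsmul A a b hqp).flip f))
      (Tot.lin_ext fun q' p' h' g' f' => ?_) m
    rw [LinearMap.comp_apply, LinearMap.comp_apply, LinearMap.flip_apply, LinearMap.flip_apply,
      freeLsmul_mk A a b hrq h' rfl, freeRsmul_mk A a b h₁ _ rfl,
      freeRsmul_mk A a b hqp h' rfl, freeLsmul_mk A a b h₂ _ rfl]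
  d_lsmul {x y z q p n} h g m := by
    refine LinearMap.congr_fun
      (f := ((Tot.tot (A.Hom b z) (A.Hom x a)).d n (n + 1)).hom.comp (freeLsmul A a b h g))
      (g := freeLsmul A a b (by omega) (((A.Hom y z).d q (q + 1)).hom g) + q.negOnePow •
        (freeLsmul A a b (by omega) g).comp ((Tot.tot (A.Hom b y) (A.Hom x a)).d p (p + 1)).hom)
      (Tot.lin_ext fun q' p' h' g' f' => ?_) m
    rw [LinearMap.add_apply, LinearMap.smul_apply, LinearMap.comp_apply, LinearMap.comp_apply,
      Tot.d_mk rfl, freeLsmul_mk A a b h h' rfl, Tot.d_mk rfl, map_add, map_zsmul_unit,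
      freeLsmul_mk A a b _ _ (show q + 1 + q' = q + q' + 1 by omega),
      freeLsmul_mk A a b _ _ (show q + (q' + 1) = q + q' + 1 by omega),
      freeLsmul_mk A a b _ _ rfl, A.leibniz]
    simp only [map_add, map_zsmul_unit, LinearMap.add_apply, LinearMap.smul_apply, smul_add,
      smul_smul, Int.negOnePow_add]
    rw [add_assoc]
  d_rsmul {x y z q p n} h m f := by
    refine LinearMap.congr_fun
      (f := ((Tot.tot (A.Hom b z) (A.Hom x a)).d n (n + 1)).hom.comp
        ((freeRsmul A a b h).flip f))
      (g := ((freeRsmul A a b (by omega)).flip f).comp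
          ((Tot.tot (A.Hom b z) (A.Hom y a)).d q (q + 1)).hom +
        q.negOnePow • (freeRsmul A a b (by omega)).flip (((A.Hom x y).d p (p + 1)).hom f))
      (Tot.lin_ext fun q' p' h' g' f' => ?_) m
    rw [LinearMap.add_apply, LinearMap.smul_apply, LinearMap.comp_apply, LinearMap.comp_apply,
      LinearMap.flip_apply, LinearMap.flip_apply, LinearMap.flip_apply,
      Tot.d_mk rfl, freeRsmul_mk A a b h h' rfl, Tot.d_mk rfl, map_add, map_zsmul_unit,
      LinearMap.add_apply, LinearMap.smul_apply,
      freeRsmul_mk A a b _ _ rfl,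
      freeRsmul_mk A a b _ _ (show p' + 1 + p = p' + p + 1 by omega),
      freeRsmul_mk A a b _ _ (show p' + (p + 1) = p' + p + 1 by omega), A.leibniz]
    simp only [map_add, map_zsmul_unit, smul_add, smul_smul, ← Int.negOnePow_add, ← h']
    exact (add_assoc _ _ _).symm

/-- The generator is `1 ⊗ 1`; by the unit laws the map g ⊗ f ↦ g · e · f is then the identity. -/
lemma free_isRepresentable : (free A a b).IsRepresentable a b := by
  have hone : ∀ x : A.Obj, ((A.Hom x x).d 0 (0 + 1)).hom (A.one x) = 0 := A.d_one
  refine ⟨Tot.mk (A.Hom b b) (A.Hom a a) (zero_add 0) (A.one b) (A.one a), ?_, fun x y n => ?_⟩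
  · change ((Tot.tot (A.Hom b b) (A.Hom a a)).d 0 1).hom _ = 0
    rw [Tot.d_mk (zero_add 1), hone, hone]
    simp
  · have hid : Tot.lift (fun q p h => (freeRsmul A a b h).comp
        ((freeLsmul A a b (add_zero q)).flip
          (Tot.mk (A.Hom b b) (A.Hom a a) (zero_add 0) (A.one b) (A.one a)))) =
        (LinearMap.id : (Tot.tot (A.Hom b y) (A.Hom x a)).X n →ₗ[k] _) := by
      refine Tot.lin_ext fun q p h g f => (Tot.lift_mk _ h g f).trans ?_
      rw [LinearMap.comp_apply, LinearMap.flip_apply, freeLsmul_mk A a b _ _ (add_zero q),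
        freeRsmul_mk A a b _ _ (zero_add p), A.one_comp,
        A.comp_one]
      rfl
    have hbij := Function.bijective_id (α := (Tot.tot (A.Hom b y) (A.Hom x a)).X n)
    rw [← LinearMap.id_coe (R := k), ← hid] at hbij
    exact hbij

end Free

/-- The identity g · (v · e · u) · f = (g ∘ v) · e · (u ∘ f). It compares the map defined by the new
generator v · e · u with the one defined by `e`. -/
lemma rsmul_lsmul_rsmul_lsmul (M : DGBimodule A) {x y a b a' b' : A.Obj} {q p n : ℤ}
    (h : q + p = n) (g : (A.Hom b' y).X q) (v : (A.Hom b b').X 0) (e : (M.M a b).X 0)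
    (u : (A.Hom a' a).X 0) (f : (A.Hom x a').X p) :
    M.rsmul h (M.lsmul (add_zero q) g (M.rsmul (add_zero 0) (M.lsmul (add_zero 0) v e) u)) f =
      M.rsmul h (M.lsmul (add_zero q) (A.comp (add_zero q) g v) e) (A.comp (zero_add p) u f) := by
  rw [← M.lsmul_rsmul (add_zero q) _ (add_zero q), ← M.comp_lsmul (add_zero q) _ (add_zero q),
    M.rsmul_comp (add_zero q) (zero_add p)]

section Desc

variable (M : DGBimodule A) {a b : A.Obj} (e : (M.M a b).X 0)

/-- The linear maps `g ⊗ f ↦ g · e · f`. -/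
noncomputable def descLin (x y : A.Obj) (n : ℤ) :
    (Tot.tot (A.Hom b y) (A.Hom x a)).X n →ₗ[k] (M.M x y).X n :=
  Tot.lift fun q _ h => (M.rsmul h).comp ((M.lsmul (add_zero q)).flip e)

lemma descLin_mk {x y : A.Obj} {q p n : ℤ} (h : q + p = n) (g : (A.Hom b y).X q)
    (f : (A.Hom x a).X p) : M.descLin e x y n (Tot.mk _ _ h g f) =
      M.rsmul h (M.lsmul (add_zero q) g e) f := by
  simp [descLin]

/-- The morphism from the free bimodule attached to a closed element of degree `0`. -/
noncomputable def desc (he : ((M.M a b).d 0 1).hom e = 0) : Morphism (free A a b) M where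
  app x y :=
    { f n := Tot.ofLin (M.descLin e x y n)
      comm' i j hij := by
        obtain rfl : i + 1 = j := hij
        ext1
        refine Tot.lin_ext fun q p h g f => ?_
        change ((M.M x y).d i (i + 1)).hom (M.descLin e x y i _) = M.descLin e x y (i + 1)
          (((Tot.tot (A.Hom b y) (A.Hom x a)).d i (i + 1)).hom _)
        have he' : ((M.M a b).d 0 (0 + 1)).hom e = 0 := he
        rw [Tot.d_mk rfl, map_add, map_zsmul_unit, descLin_mk, descLin_mk, descLin_mk, M.d_rsmul,
          M.d_lsmul, he']
        simp }
  map_lsmul {x y z q p n} h g m := by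
    refine LinearMap.congr_fun (f := (M.descLin e x z n).comp (freeLsmul A a b h g))
      (g := (M.lsmul h g).comp (M.descLin e x y p)) (Tot.lin_ext fun q' p' h' g' f => ?_) m
    rw [LinearMap.comp_apply, LinearMap.comp_apply, freeLsmul_mk A a b _ _ rfl, descLin_mk,
      descLin_mk, ← M.lsmul_rsmul rfl _ (by omega), M.comp_lsmul]
  map_rsmul {x y z q p n} h m f := by
    refine LinearMap.congr_fun (f := (M.descLin e x z n).comp ((freeRsmul A a b h).flip f))
      (g := ((M.rsmul h).flip f).comp (M.descLin e y z q))
      (Tot.lin_ext fun q' p' h' g' f' => ?_) m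
    rw [LinearMap.comp_apply, LinearMap.comp_apply, LinearMap.flip_apply, LinearMap.flip_apply,
      freeRsmul_mk A a b _ _ rfl, descLin_mk, descLin_mk, M.rsmul_comp]

lemma isIso_desc_app (he : ((M.M a b).d 0 1).hom e = 0) (x y : A.Obj)
    (h : ∀ n : ℤ, Function.Bijective (M.descLin e x y n)) : IsIso ((M.desc e he).app x y) := by
  have : ∀ n, IsIso (((M.desc e he).app x y).f n) := fun n =>
    (ConcreteCategory.isIso_iff_bijective _).2 (h n)
  exact HomologicalComplex.Hom.isIso_of_components _

end Desc

end DGBimodule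

namespace DGCategory

variable (A : DGCategory.{w, v} k)

/-- The full dg subcategory on the objects satisfying a property. -/
def full (P : A.Obj → Prop) : DGCategory.{w, v} k where
  Obj := {x : A.Obj // P x}
  Hom x y := A.Hom x.1 y.1
  comp h := A.comp h
  one x := A.one x.1
  d_one x := A.d_one x.1
  one_comp := A.one_comp
  comp_one := A.comp_one
  assoc := A.assoc
  leibniz := A.leibniz

variable {A}

/-- Composition with a closed morphism of degree `0`. -/
def postcomp {a' a : A.Obj} (u : A.Z a' a 0) (x : A.Obj) : A.Hom x a' ⟶ A.Hom x a where
  f n := Tot.ofLin (A.comp (zero_add n) u.1)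
  comm' i j hij := by
    obtain rfl : i + 1 = j := hij
    ext f
    refine (A.leibniz (zero_add i) u.1 f).trans ?_
    rw [LinearMap.mem_ker.1 u.2]
    simp

/-- Precomposition with a closed morphism of degree `0`. -/
def precomp {b b' : A.Obj} (u : A.Z b b' 0) (y : A.Obj) : A.Hom b' y ⟶ A.Hom b y where
  f n := Tot.ofLin ((A.comp (add_zero n)).flip u.1)
  comm' i j hij := by
    obtain rfl : i + 1 = j := hij
    ext f
    refine (A.leibniz (add_zero i) f u.1).trans ?_
    rw [LinearMap.mem_ker.1 u.2]
    simp

end DGCategory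

namespace DGBimodule

variable {A : DGCategory.{w, v} k} (P : A.Obj → Prop)

/-- The restriction of a bimodule to a full dg subcategory. -/
def restrict (M : DGBimodule A) : DGBimodule (A.full P) where
  M x y := M.M x.1 y.1
  lsmul h := M.lsmul h
  rsmul h := M.rsmul h
  one_lsmul := M.one_lsmul
  rsmul_one := M.rsmul_one
  comp_lsmul := M.comp_lsmul
  rsmul_comp := M.rsmul_comp
  lsmul_rsmul := M.lsmul_rsmul
  d_lsmul := M.d_lsmul
  d_rsmul := M.d_rsmul

/-- The restriction of a morphism to a full dg subcategory. -/
def Morphism.restrict {M N : DGBimodule A} (φ : Morphism M N) :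
    Morphism (M.restrict P) (N.restrict P) where
  app x y := φ.app x.1 y.1
  map_lsmul := φ.map_lsmul
  map_rsmul := φ.map_rsmul

variable {P}

/-- On the subcategory, composing with `u` and `v` is a quasi-isomorphism in each tensor factor, so
the free bimodule at `(a', b')`, which does live on the subcategory, maps quasi-isomorphically to
the restriction of `M`. -/
lemma isPerfect_restrict_of_isRepresentable {M : DGBimodule A} {a b : A.Obj}
    (hM : M.IsRepresentable a b) {a' b' : A.Obj} (ha' : P a') (hb' : P b')
    (u : A.Z a' a 0) (v : A.Z b b' 0)
    (hu : ∀ x, P x → QuasiIso (DGCategory.postcomp u x))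
    (hv : ∀ y, P y → QuasiIso (DGCategory.precomp v y)) : (M.restrict P).IsPerfect := by
  obtain ⟨e, he, hbij⟩ := hM
  have hu' : ((A.Hom a' a).d 0 (0 + 1)).hom u.1 = 0 := LinearMap.mem_ker.1 u.2
  have hv' : ((A.Hom b b').d 0 (0 + 1)).hom v.1 = 0 := LinearMap.mem_ker.1 v.2
  let e' : (M.M a' b').X 0 := M.rsmul (add_zero 0) (M.lsmul (add_zero 0) v.1 e) u.1
  have he' : ((M.M a' b').d 0 (0 + 1)).hom e' = 0 := by
    have he₀ : ((M.M a b).d 0 (0 + 1)).hom e = 0 := he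
    simp only [e']
    rw [M.d_rsmul, M.d_lsmul, hu', hv', he₀]
    simp
  let Φ := (M.restrict P).desc (a := ⟨a', ha'⟩) (b := ⟨b', hb'⟩) e' he'
  refine .of_quasiIso Φ (fun x y => ?_) (.representable _ _ _ (free_isRepresentable _ _ _))
  -- The comparison map is the tensor product of the two quasi-isomorphisms followed by the
  -- isomorphism given by the generator `e`.
  have hfac : Φ.app x y = Tot.map (DGCategory.precomp v y.1) (DGCategory.postcomp u x.1) ≫
      (M.desc e he).app x.1 y.1 := by
    ext n : 2
    refine Tot.lin_ext fun q p h g f => ?_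
    refine ((M.restrict P).descLin_mk (a := ⟨a', ha'⟩) (b := ⟨b', hb'⟩) e' h g f).trans ?_
    refine Eq.trans ?_ (congrArg (M.descLin e x.1 y.1 n) (Tot.map_f_mk _ _ h g f)).symm
    rw [descLin_mk]
    change M.rsmul h (M.lsmul _ g (M.rsmul _ (M.lsmul _ v.1 e) u.1)) f =
      M.rsmul h (M.lsmul _ (A.comp _ g v.1) e) (A.comp _ u.1 f)
    exact M.rsmul_lsmul_rsmul_lsmul h g v.1 e u.1 f
  have h₁ := Tot.quasiIso_map _ _ (hv y.1 y.2) (hu x.1 x.2)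
  have := M.isIso_desc_app e he x.1 y.1 (hbij x.1 y.1)
  have h₂ : QuasiIso ((M.desc e he).app x.1 y.1) := inferInstance
  rw [hfac]
  exact quasiIso_comp (hφ := h₁) (hφ' := h₂) _ _

/-- Every closure property of perfect bimodules is tested pointwise and so survives restriction;
only the representable ones need the hypotheses. The approximations go `a' → a` but `b → b'` because
A(b, -) ⊗ A(-, a) is contravariant in `b` and covariant in `a`. -/
lemma isPerfect_restrict
    (hP : ∀ a : A.Obj, ∃ (a' : A.Obj) (_ : P a') (u : A.Z a' a 0),
      ∀ x, P x → QuasiIso (DGCategory.postcomp u x))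
    (hP' : ∀ b : A.Obj, ∃ (b' : A.Obj) (_ : P b') (v : A.Z b b' 0),
      ∀ y, P y → QuasiIso (DGCategory.precomp v y))
    {M : DGBimodule A} (hM : M.IsPerfect) : (M.restrict P).IsPerfect := by
  induction hM with
  | representable M a b h =>
    obtain ⟨a', ha', u, hu⟩ := hP a
    obtain ⟨b', hb', v, hv⟩ := hP' b
    exact isPerfect_restrict_of_isRepresentable h ha' hb' u v hu hv
  | zero M h => exact .zero _ fun x y n => h x.1 y.1 n
  | of_quasiIso φ hφ _ ih => exact .of_quasiIso (φ.restrict P) (fun x y => hφ x.1 y.1) ih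
  | of_quasiIso_symm φ hφ _ ih => exact .of_quasiIso_symm (φ.restrict P) (fun x y => hφ x.1 y.1) ih
  | left φ ψ h _ _ ih₁ ih₂ =>
    exact .left (φ.restrict P) (ψ.restrict P) (fun x y n => h x.1 y.1 n) ih₁ ih₂
  | middle φ ψ h _ _ ih₁ ih₂ =>
    exact .middle (φ.restrict P) (ψ.restrict P) (fun x y n => h x.1 y.1 n) ih₁ ih₂
  | right φ ψ h _ _ ih₁ ih₂ =>
    exact .right (φ.restrict P) (ψ.restrict P) (fun x y n => h x.1 y.1 n) ih₁ ih₂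
  | retract i r h _ ih =>
    exact .retract (i.restrict P) (r.restrict P) (fun x y => h x.1 y.1) ih

end DGBimodule

/-- The diagonal bimodule restricts, by definition, to the diagonal bimodule of the full
subcategory. -/
lemma DGCategory.IsSmooth.full {A : DGCategory.{w, v} k} (hA : A.IsSmooth) {P : A.Obj → Prop}
    (hP : ∀ a : A.Obj, ∃ (a' : A.Obj) (_ : P a') (u : A.Z a' a 0),
      ∀ x, P x → QuasiIso (DGCategory.postcomp u x))
    (hP' : ∀ b : A.Obj, ∃ (b' : A.Obj) (_ : P b') (v : A.Z b b' 0),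
      ∀ y, P y → QuasiIso (DGCategory.precomp v y)) : (A.full P).IsSmooth :=
  DGBimodule.isPerfect_restrict hP hP' hA

lemma DGCategory.IsProper.full {A : DGCategory.{w, v} k} (hA : A.IsProper) (P : A.Obj → Prop) :
    (A.full P).IsProper := fun x y => hA x.1 y.1

end DG

open Pretriangulated

/-! ### Iterates of endofunctors -/

section Iterate

variable {T : Type u} [Category.{v} T] (τ : T ⥤ T)

/-- `iterate` adds the new copy of `τ` at the end; this moves it to the front, so that a power of
`τ` factors through `τ` on both sides. -/
lemma comp_iterate (n : ℕ) : τ ⋙ iterate τ n = iterate τ (n + 1) := by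
  induction n with
  | zero => rfl
  | succ n ih =>
    change (τ ⋙ iterate τ n) ⋙ τ = _
    rw [ih]
    rfl

instance iterate_isEquivalence [τ.IsEquivalence] (n : ℕ) : (iterate τ n).IsEquivalence := by
  induction n with
  | zero => exact inferInstanceAs (𝟭 T).IsEquivalence
  | succ n ih => exact inferInstanceAs (iterate τ n ⋙ τ).IsEquivalence

/-- An endofunctor with an iterate that is an equivalence is an equivalence. -/
lemma isEquivalence_of_iterate (n : ℕ) (h : (iterate τ (n + 1)).IsEquivalence) :
    τ.IsEquivalence := by
  have h₁ : (iterate τ n ⋙ τ).IsEquivalence := h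
  have h₂ : (τ ⋙ iterate τ n).IsEquivalence := by rwa [comp_iterate]
  have : (iterate τ n).Faithful := Functor.Faithful.of_comp (iterate τ n) τ
  have : τ.Faithful := Functor.Faithful.of_comp τ (iterate τ n)
  have : τ.Full := Functor.Full.of_comp_faithful τ (iterate τ n)
  have : τ.EssSurj := ⟨fun X => ⟨(iterate τ n).obj ((iterate τ n ⋙ τ).objPreimage X),
    ⟨(iterate τ n ⋙ τ).objObjPreimageIso X⟩⟩⟩
  exact {}

end Iterate

section

variable {T : Type u} [Category.{v} T] [Preadditive T]

lemma rightOrthogonal_map {a : ObjectProperty T} {F : T ⥤ T} [F.Full] [F.Faithful]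
    [F.PreservesZeroMorphisms] {X : T} (hX : a.rightOrthogonal X) :
    (a.map F).rightOrthogonal (F.obj X) := by
  intro Z f hZ
  rw [ObjectProperty.prop_map_iff] at hZ
  obtain ⟨A, hA, ⟨e⟩⟩ := hZ
  obtain ⟨g, hg⟩ := F.map_surjective (e.hom ≫ f)
  rw [← cancel_epi e.hom, ← hg, hX g hA, Functor.map_zero, comp_zero]

lemma leftOrthogonal_map {a : ObjectProperty T} {F : T ⥤ T} [F.Full] [F.Faithful]
    [F.PreservesZeroMorphisms] {X : T} (hX : a.leftOrthogonal X) :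
    (a.map F).leftOrthogonal (F.obj X) := by
  intro Z f hZ
  rw [ObjectProperty.prop_map_iff] at hZ
  obtain ⟨A, hA, ⟨e⟩⟩ := hZ
  obtain ⟨g, hg⟩ := F.map_surjective (f ≫ e.inv)
  rw [← cancel_mono e.inv, ← hg, hX g hA, Functor.map_zero, zero_comp]

end

section

variable {T : Type u} [Category.{v} T] [Preadditive T] [HasZeroObject T]
  [HasShift T ℤ] [∀ n : ℤ, (shiftFunctor T n).Additive] [Pretriangulated T]

section IterateTriangulated

variable (τ : T ⥤ T) [τ.CommShift ℤ] [τ.IsTriangulated]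

noncomputable instance iterateCommShift : ∀ n : ℕ, (iterate τ n).CommShift ℤ
  | 0 => inferInstanceAs ((𝟭 T).CommShift ℤ)
  | n + 1 =>
    letI := iterateCommShift n
    inferInstanceAs ((iterate τ n ⋙ τ).CommShift ℤ)

instance iterate_isTriangulated (n : ℕ) : (iterate τ n).IsTriangulated := by
  induction n with
  | zero => exact inferInstanceAs (𝟭 T).IsTriangulated
  | succ n ih => exact inferInstanceAs (iterate τ n ⋙ τ).IsTriangulated

end IterateTriangulated

/-! ### Triangulated hulls and their orthogonals -/

section Hull

variable (P : ObjectProperty T)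

lemma le_triangulatedHull : P ≤ triangulatedHull P := fun X hX _ _ _ h => h X hX

lemma triangulatedHull_le {Q : ObjectProperty T} [hQ : Q.IsTriangulated]
    [hQ' : Q.IsClosedUnderIsomorphisms] (h : P ≤ Q) : triangulatedHull P ≤ Q :=
  fun _ hX => hX Q hQ hQ' h

/-- The left orthogonal of `P^⊥` is a triangulated subcategory containing `P`, hence contains the
hull. Stability of `P` under shift makes these orthogonals triangulated. -/
lemma rightOrthogonal_triangulatedHull [P.IsStableUnderShift ℤ] {X : T}
    (hX : P.rightOrthogonal X) : (triangulatedHull P).rightOrthogonal X := fun _ f hY =>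
  triangulatedHull_le P (Q := P.rightOrthogonal.leftOrthogonal) (fun _ hZ _ g hW => hW g hZ)
    _ hY f hX

lemma leftOrthogonal_triangulatedHull [P.IsStableUnderShift ℤ] {X : T}
    (hX : P.leftOrthogonal X) : (triangulatedHull P).leftOrthogonal X := fun _ f hY =>
  triangulatedHull_le P (Q := P.leftOrthogonal.rightOrthogonal) (fun _ hZ _ g hW => hW g hZ)
    _ hY f hX

instance iSup_isStableUnderShift {ι : Type*} (Q : ι → ObjectProperty T)
    [∀ i, (Q i).IsStableUnderShift ℤ] : (⨆ i, Q i).IsStableUnderShift ℤ where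
  isStableUnderShiftBy n := ⟨fun X hX => by
    rw [ObjectProperty.prop_iSup_iff] at hX
    rw [ObjectProperty.prop_shift_iff, ObjectProperty.prop_iSup_iff]
    obtain ⟨i, hi⟩ := hX
    exact ⟨i, (Q i).le_shift n _ hi⟩⟩

end Hull

/-! ### Reflections and coreflections for semiorthogonal collections -/

section Reflections

/-- Every object has a morphism to an object of `a^⊥` with cone in `a`. -/
def HasReflections (a : ObjectProperty T) : Prop :=
  ∀ X : T, ∃ (Y : T) (f : X ⟶ Y), a.trW f ∧ a.rightOrthogonal Y

/-- Every object has a morphism from an object of `^⊥a` with cone in `a`. -/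
def HasCoreflections (a : ObjectProperty T) : Prop :=
  ∀ X : T, ∃ (Y : T) (f : Y ⟶ X), a.trW f ∧ a.leftOrthogonal Y

lemma LeftMutation.trW_unit (a : ObjectProperty T) [IsAdmissible a] (X : T) :
    a.trW (LeftMutation.unit a X) :=
  ObjectProperty.trW.mk' a (distinguished a X) (a.ι.rightAdjoint.obj X).property

lemma IsAdmissible.hasReflections (a : ObjectProperty T) [IsAdmissible a] : HasReflections a :=
  fun X => ⟨_, _, LeftMutation.trW_unit a X, LeftMutation.rightOrthogonal_obj a X⟩

/-- Dual to left mutation: the coreflection of X is the fibre of the unit `η` from X to its image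
under the left adjoint of the inclusion. -/
lemma IsAdmissible.hasCoreflections (a : ObjectProperty T) [IsAdmissible a] :
    HasCoreflections a := fun X => by
  let adj := Adjunction.ofIsRightAdjoint a.ι
  let η : X ⟶ (a.ι.leftAdjoint.obj X).obj := adj.unit.app X
  have hA : a (a.ι.leftAdjoint.obj X).obj := (a.ι.leftAdjoint.obj X).property
  have hfac : ∀ {B : T} (_ : a B) (g : X ⟶ B), ∃ h, η ≫ h = g := fun {B} hB g => by
    let B' : a.FullSubcategory := ⟨B, hB⟩
    let g' : X ⟶ a.ι.obj B' := g
    have := (adj.homEquiv_unit X B' ((adj.homEquiv X B').symm g')).symm.trans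
      ((adj.homEquiv X B').apply_symm_apply g')
    exact ⟨_, this⟩
  have hzero : ∀ {B : T} (_ : a B) (h : (a.ι.leftAdjoint.obj X).obj ⟶ B), η ≫ h = 0 → h = 0 :=
      fun {B} hB h w => by
    let B' : a.FullSubcategory := ⟨B, hB⟩
    let h' : a.ι.leftAdjoint.obj X ⟶ B' := ObjectProperty.homMk h
    have h₁ : adj.homEquiv X B' h' = adj.homEquiv X B' 0 := by
      rw [adj.homEquiv_unit, adj.homEquiv_unit, Functor.map_zero, comp_zero]
      exact w
    have h₂ : h' = 0 := (adj.homEquiv X B').injective h₁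
    exact congrArg InducedCategory.Hom.hom h₂
  obtain ⟨Y, f, δ, hT⟩ := distinguished_cocone_triangle₁ η
  refine ⟨Y, f, ObjectProperty.trW.mk a hT hA, fun B g hB => ?_⟩
  -- Since `g⟦1⟧` vanishes on `δ`, the map `g` factors through `f` by a map X → B, and that map
  -- factors through `η`; as `f ≫ η = 0`, `g` vanishes.
  have h₁ : δ ≫ g⟦(1 : ℤ)⟧' = 0 := hzero (a.le_shift (1 : ℤ) _ hB) _ (by
    have h₃ : η ≫ δ = 0 := comp_distTriang_mor_zero₂₃ _ hT
    rw [← Category.assoc, h₃, zero_comp])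
  obtain ⟨l, hl⟩ : ∃ l, g⟦(1 : ℤ)⟧' = (-f⟦(1 : ℤ)⟧') ≫ l :=
    Triangle.yoneda_exact₃ _ (rot_of_distTriang _ hT) (g⟦(1 : ℤ)⟧') h₁
  obtain ⟨l, rfl⟩ := (shiftFunctor T (1 : ℤ)).map_surjective l
  obtain ⟨l, rfl⟩ := hfac hB l
  have h₃ : f ≫ η = 0 := comp_distTriang_mor_zero₁₂ _ hT
  apply (shiftFunctor T (1 : ℤ)).map_injective
  rw [hl, Preadditive.neg_comp, ← Functor.map_comp, ← Category.assoc, h₃, zero_comp,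
    Functor.map_zero, neg_zero]

lemma trW_map {a b : ObjectProperty T} {F : T ⥤ T} [F.CommShift ℤ]
    [F.IsTriangulated] (h : ∀ X, a X → b (F.obj X)) {X Y : T} {f : X ⟶ Y} (hf : a.trW f) :
    b.trW (F.map f) := by
  obtain ⟨Z, g, δ, hT, hZ⟩ := hf
  exact ObjectProperty.trW.mk b (F.map_distinguished _ hT) (h Z hZ)

section

variable {a : ObjectProperty T} (F : T ⥤ T) [F.CommShift ℤ] [F.IsTriangulated] [F.IsEquivalence]

lemma HasReflections.map (h : HasReflections a) : HasReflections (a.map F) := fun X => by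
  obtain ⟨Y, f, hf, hY⟩ := h (F.objPreimage X)
  refine ⟨F.obj Y, (F.objObjPreimageIso X).inv ≫ F.map f, ?_, rightOrthogonal_map hY⟩
  have : (a.map F).trW (F.map f) :=
    trW_map (fun Z hZ => a.prop_map_obj F hZ) hf
  exact ((a.map F).trW.cancel_left_of_respectsIso _ _).2 this

lemma HasCoreflections.map (h : HasCoreflections a) : HasCoreflections (a.map F) := fun X => by
  obtain ⟨Y, f, hf, hY⟩ := h (F.objPreimage X)
  refine ⟨F.obj Y, F.map f ≫ (F.objObjPreimageIso X).hom, ?_, leftOrthogonal_map hY⟩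
  have : (a.map F).trW (F.map f) :=
    trW_map (fun Z hZ => a.prop_map_obj F hZ) hf
  exact ((a.map F).trW.cancel_right_of_respectsIso _ _).2 this

end

lemma rightOrthogonal_of_trW {a b : ObjectProperty T} [b.IsStableUnderShift ℤ] {X Y : T}
    {f : X ⟶ Y} (hf : a.trW f) (h : a ≤ b.rightOrthogonal) (hX : b.rightOrthogonal X) :
    b.rightOrthogonal Y := by
  obtain ⟨Z, g, δ, hT, hZ⟩ := hf
  exact b.rightOrthogonal.ext_of_isTriangulatedClosed₂ _ hT hX (h _ hZ)

lemma leftOrthogonal_of_trW {a b : ObjectProperty T} [b.IsStableUnderShift ℤ] {X Y : T}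
    {f : X ⟶ Y} (hf : a.trW f) (h : a ≤ b.leftOrthogonal) (hY : b.leftOrthogonal Y) :
    b.leftOrthogonal X := by
  obtain ⟨Z, g, δ, hT, hZ⟩ := hf
  exact b.leftOrthogonal.ext_of_isTriangulatedClosed₁ _ hT hY (h _ hZ)

section Semiorthogonal

variable [IsTriangulated T] {m : ℕ} {A : Fin m → ObjectProperty T} [∀ i, (A i).IsTriangulated]

/-- The blocks are removed from the last to the first. The cone of each step lies in a block that
receives no maps from the later blocks, so the orthogonality already reached is kept. -/
lemma hasReflections_hull (hA : IsSemiorthogonal A) (h : ∀ i, HasReflections (A i)) :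
    HasReflections (triangulatedHull (⨆ i, A i)) := by
  have key : ∀ j : ℕ, j ≤ m → ∀ X : T, ∃ (Y : T) (f : X ⟶ Y), (triangulatedHull (⨆ i, A i)).trW f ∧
      ∀ i : Fin m, m ≤ i + j → (A i).rightOrthogonal Y := by
    intro j
    induction j with
    | zero =>
      intro _ X
      exact ⟨X, 𝟙 X, ObjectProperty.trW_of_isIso _ _, fun i hi => by have := i.2; omega⟩
    | succ j ih =>
      intro hj X
      obtain ⟨Y, f, hf, hY⟩ := ih (by omega) X
      -- After `j` steps the last `j` blocks, those with index at least `m - j`, have been treated;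
      -- this is the next one.
      let i₀ : Fin m := ⟨m - j - 1, by omega⟩
      obtain ⟨Y', f', hf', hY'⟩ := h i₀ Y
      refine ⟨Y', f ≫ f', (triangulatedHull _).trW.comp_mem _ _ hf
        (ObjectProperty.trW_monotone ((le_iSup A i₀).trans (le_triangulatedHull _)) _ hf'),
        fun i hi => ?_⟩
      by_cases hii : i = i₀
      · rw [hii]
        exact hY'
      · have hne : (i : ℕ) ≠ m - j - 1 := fun h => hii (Fin.ext h)
        have hlt : i₀ < i := Fin.lt_def.2 (show m - j - 1 < (i : ℕ) by omega)
        exact rightOrthogonal_of_trW hf' (fun Z hZ W g hW => hA i₀ i hlt W Z hW hZ g)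
          (hY i (by omega))
  intro X
  obtain ⟨Y, f, hf, hY⟩ := key m le_rfl X
  refine ⟨Y, f, hf, rightOrthogonal_triangulatedHull _ fun Z g hZ => ?_⟩
  rw [ObjectProperty.prop_iSup_iff] at hZ
  obtain ⟨i, hi⟩ := hZ
  exact hY i (by omega) g hi

/-- Here the blocks are removed from the first to the last: a block has no maps to the earlier ones,
so left orthogonality to those persists. -/
lemma hasCoreflections_hull (hA : IsSemiorthogonal A) (h : ∀ i, HasCoreflections (A i)) :
    HasCoreflections (triangulatedHull (⨆ i, A i)) := by
  have key : ∀ j : ℕ, j ≤ m → ∀ X : T, ∃ (Y : T) (f : Y ⟶ X), (triangulatedHull (⨆ i, A i)).trW f ∧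
      ∀ i : Fin m, i < j → (A i).leftOrthogonal Y := by
    intro j
    induction j with
    | zero =>
      intro _ X
      exact ⟨X, 𝟙 X, ObjectProperty.trW_of_isIso _ _, fun i hi => by omega⟩
    | succ j ih =>
      intro hj X
      obtain ⟨Y, f, hf, hY⟩ := ih (by omega) X
      let i₀ : Fin m := ⟨j, by omega⟩
      obtain ⟨Y', f', hf', hY'⟩ := h i₀ Y
      refine ⟨Y', f' ≫ f, (triangulatedHull _).trW.comp_mem _ _
        (ObjectProperty.trW_monotone ((le_iSup A i₀).trans (le_triangulatedHull _)) _ hf') hf,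
        fun i hi => ?_⟩
      by_cases hii : i = i₀
      · rw [hii]
        exact hY'
      · have hne : (i : ℕ) ≠ j := fun h => hii (Fin.ext h)
        have hlt : i < i₀ := Fin.lt_def.2 (show (i : ℕ) < j by omega)
        exact leftOrthogonal_of_trW hf' (fun Z hZ W g hW => hA i i₀ hlt Z W hZ hW g)
          (hY i (by omega))
  intro X
  obtain ⟨Y, f, hf, hY⟩ := key m le_rfl X
  refine ⟨Y, f, hf, leftOrthogonal_triangulatedHull _ fun Z g hZ => ?_⟩
  rw [ObjectProperty.prop_iSup_iff] at hZ
  obtain ⟨i, hi⟩ := hZ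
  exact hY i i.2 g hi

end Semiorthogonal

end Reflections

end

/-! ### Left mutation as an exact functor -/

section LeftMutation

variable {T : Type u} [Category.{v} T] [Preadditive T] [HasZeroObject T]
  [HasShift T ℤ] [∀ n : ℤ, (shiftFunctor T n).Additive] [Pretriangulated T]
  (a : ObjectProperty T) [IsAdmissible a]

namespace LeftMutation

lemma unit_naturality {X Y : T} (f : X ⟶ Y) :
    f ≫ unit a Y = unit a X ≫ (leftMutation a).map f :=
  (existsUnique_desc a (rightOrthogonal_obj a Y) (f ≫ unit a Y)).choose_spec.1.symm

/-- The left mutation functor, as a functor to `a^⊥`. -/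
noncomputable def reflection : T ⥤ a.rightOrthogonal.FullSubcategory :=
  a.rightOrthogonal.lift (leftMutation a) (rightOrthogonal_obj a)

/-- Morphisms `L_a(X) ⟶ G` to an object of `a^⊥` correspond to morphisms `X ⟶ G`. -/
noncomputable def reflectionHomEquiv (X : T) (G : a.rightOrthogonal.FullSubcategory) :
    ((reflection a).obj X ⟶ G) ≃ (X ⟶ G.obj) :=
  Equiv.ofBijective (fun h => unit a X ≫ h.hom) (by
    refine ⟨fun h h' hh => ?_, fun g => ?_⟩
    · ext
      exact (existsUnique_desc a G.property (unit a X ≫ h'.hom)).unique hh rfl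
    · obtain ⟨h, hh, -⟩ := existsUnique_desc a G.property g
      exact ⟨ObjectProperty.homMk h, hh⟩)

/-- The left mutation functor is left adjoint to the inclusion of `a^⊥`. -/
noncomputable def reflectionAdj : reflection a ⊣ a.rightOrthogonal.ι :=
  Adjunction.mkOfHomEquiv
    { homEquiv := reflectionHomEquiv a
      homEquiv_naturality_left_symm {X X' G} f g := by
        rw [Equiv.symm_apply_eq]
        obtain ⟨l, rfl⟩ := (reflectionHomEquiv a X' G).surjective g
        rw [Equiv.symm_apply_apply]
        refine (Category.assoc _ _ _).symm.trans ?_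
        exact (congrArg (· ≫ l.hom) (unit_naturality a f)).trans (Category.assoc _ _ _)
      homEquiv_naturality_right {X G G'} f g := (Category.assoc _ _ _).symm }

/-- Cones are not functorial, so compatibility with shifts and exactness are taken from the
adjunction: a left adjoint of an exact functor is exact. -/
noncomputable instance : (reflection a).CommShift ℤ := (reflectionAdj a).leftAdjointCommShift ℤ

noncomputable instance : (reflectionAdj a).CommShift ℤ :=
  (reflectionAdj a).commShift_of_rightAdjoint ℤ

instance : (reflection a).IsTriangulated := (reflectionAdj a).isTriangulated_leftAdjoint

noncomputable instance : (leftMutation a).CommShift ℤ :=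
  inferInstanceAs ((reflection a ⋙ a.rightOrthogonal.ι).CommShift ℤ)

instance : (leftMutation a).IsTriangulated :=
  inferInstanceAs (reflection a ⋙ a.rightOrthogonal.ι).IsTriangulated

lemma leftMutation_map_smul {k : Type w} [Semiring k] [Linear k T] {X Y : T} (r : k) (f : X ⟶ Y) :
    (leftMutation a).map (r • f) = r • (leftMutation a).map f := by
  refine (existsUnique_desc a (rightOrthogonal_obj a Y) ((r • f) ≫ unit a Y)).unique
    (unit_naturality a _).symm ?_
  exact (Linear.comp_smul _ _ _ (unit a X) r ((leftMutation a).map f)).trans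
    ((congrArg (r • ·) (unit_naturality a f).symm).trans (Linear.smul_comp _ _ _ r f _).symm)

lemma map_comp_unit (τ : T ⥤ T) {X X' Y Y' : T} (f : X ⟶ X') (g : Y ⟶ Y') (s : X ⟶ Y)
    (s' : X' ⟶ Y') (w : f ≫ s' = s ≫ g) : τ.map f ≫ τ.map s' ≫ unit a (τ.obj Y') =
      (τ.map s ≫ unit a (τ.obj Y)) ≫ (leftMutation a).map (τ.map g) := by
  refine (Category.assoc _ _ _).symm.trans ?_
  rw [← τ.map_comp, w, τ.map_comp, Category.assoc, unit_naturality]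
  exact (Category.assoc _ _ _).symm

end LeftMutation

end LeftMutation

/-! ### The residual category and the powers of `L_a ∘ τ` -/

section Residual

variable {T : Type u} [Category.{v} T] [Preadditive T] [HasZeroObject T]
  [HasShift T ℤ] [∀ n : ℤ, (shiftFunctor T n).Additive] [Pretriangulated T]
  (τ : T ⥤ T) (a : ObjectProperty T)

/-- The subcategory `⟨a, τ(a), …, τ^{n-1}(a)⟩`. -/
abbrev iterateHull (n : ℕ) : ObjectProperty T :=
  triangulatedHull (⨆ i : Fin n, a.map (iterate τ i))

lemma le_iterateHull_succ (n : ℕ) : a ≤ iterateHull τ a (n + 1) := fun X hX => by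
  refine le_triangulatedHull _ _ ?_
  rw [ObjectProperty.prop_iSup_iff]
  exact ⟨0, a.prop_map_obj (𝟭 T) hX⟩

variable [τ.CommShift ℤ] [τ.IsTriangulated]

lemma iterateHull_map {n : ℕ} (X : T) (hX : iterateHull τ a n X) :
    iterateHull τ a (n + 1) (τ.obj X) := by
  refine triangulatedHull_le _ (Q := (iterateHull τ a (n + 1)).inverseImage τ) (fun Z hZ => ?_) X hX
  rw [ObjectProperty.prop_iSup_iff] at hZ
  obtain ⟨i, hi⟩ := hZ
  rw [ObjectProperty.prop_map_iff] at hi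
  obtain ⟨A, hA, ⟨e⟩⟩ := hi
  refine (iterateHull τ a (n + 1)).prop_of_iso (τ.mapIso e) (le_triangulatedHull _ _ ?_)
  rw [ObjectProperty.prop_iSup_iff]
  exact ⟨i.succ, a.prop_map_obj (iterate τ (i + 1)) hA⟩

variable [IsAdmissible a]

section

variable {τ a} {m : ℕ} (h : ∀ X : (residual τ m a).FullSubcategory,
  residual τ m a (((residual τ m a).ι ⋙ τ ⋙ leftMutation a).obj X))

/-- The functor `L_a ∘ τ` on the residual category. -/
noncomputable abbrev residualPolarization :
    (residual τ m a).FullSubcategory ⥤ (residual τ m a).FullSubcategory :=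
  (residual τ m a).lift ((residual τ m a).ι ⋙ τ ⋙ leftMutation a) h

/-- The natural transformation from `τⁿ` to `(L_a ∘ τ)ⁿ` on the residual category. -/
noncomputable def iterateTrans : ∀ n : ℕ, (residual τ m a).ι ⋙ iterate τ n ⟶
    iterate (residualPolarization h) n ⋙ (residual τ m a).ι
  | 0 => 𝟙 (residual τ m a).ι
  | n + 1 =>
    { app X := τ.map ((iterateTrans n).app X) ≫ LeftMutation.unit a _
      naturality X Y f := by
        exact LeftMutation.map_comp_unit a τ _ _ _ _ ((iterateTrans n).naturality f) }

/-- Applying `τ` moves the cone from the hull of `n` blocks into that of `n + 1` blocks, the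
mutation unit adds a cone in `a`, and the octahedral axiom handles the composite. -/
lemma trW_iterateTrans [IsTriangulated T] (n : ℕ) (X : (residual τ m a).FullSubcategory) :
    (iterateHull τ a n).trW ((iterateTrans h n).app X) := by
  induction n with
  | zero => exact ObjectProperty.trW_of_isIso _ (𝟙 X.obj)
  | succ n ih =>
    exact (iterateHull τ a (n + 1)).trW.comp_mem _ _ (trW_map (iterateHull_map τ a) ih)
      (ObjectProperty.trW_monotone (le_iterateHull_succ τ a n) _ (LeftMutation.trW_unit a _))

end

variable [τ.IsEquivalence]

lemma residual_iff {m : ℕ} (X : T) : residual τ m a X ↔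
    ∀ i < m, ∀ (A : T) (_ : a A) (f : (iterate τ i).obj A ⟶ X), f = 0 := by
  refine ⟨fun h i hi A hA f => h f (le_triangulatedHull _ _ ?_), fun h => ?_⟩
  · rw [ObjectProperty.prop_iSup_iff]
    exact ⟨⟨i, hi⟩, a.prop_map_obj _ hA⟩
  · refine rightOrthogonal_triangulatedHull _ fun Z f hZ => ?_
    rw [ObjectProperty.prop_iSup_iff] at hZ
    obtain ⟨i, hi⟩ := hZ
    rw [ObjectProperty.prop_map_iff] at hi
    obtain ⟨A, hA, ⟨e⟩⟩ := hi
    rw [← cancel_epi e.hom, h i i.2 A hA (e.hom ≫ f), comp_zero]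

variable {τ a} in
-- Orthogonality to `a` is built into the mutation. A map from `τ^{i+1}(A)` to `L_a(τ X)` dies in
-- the shifted projection to `a` by semiorthogonality, so it lifts to `τ X`; the lift is `τ` of a
-- map `τ^i(A) → X`, which is zero.
lemma IsPrimitive.residual_leftMutation {m : ℕ} (ha : IsPrimitive τ m a) {X : T}
    (hX : residual τ m a X) : residual τ m a ((leftMutation a).obj (τ.obj X)) := by
  rw [residual_iff]
  intro i hi A hA f
  obtain _ | i := i
  · exact LeftMutation.rightOrthogonal_obj a (τ.obj X) f hA
  · have h₁ : f ≫ LeftMutation.δ a (τ.obj X) = 0 :=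
      ha.isSemiorthogonal ⟨0, by omega⟩ ⟨i + 1, hi⟩ (Fin.lt_def.2 (Nat.succ_pos i)) _ _
        (a.prop_map_obj _ hA) (a.prop_map_obj (𝟭 T)
          (a.le_shift (1 : ℤ) _ (a.ι.rightAdjoint.obj (τ.obj X)).property)) _
    obtain ⟨g, rfl⟩ : ∃ g : (iterate τ (i + 1)).obj A ⟶ τ.obj X,
        f = g ≫ LeftMutation.unit a (τ.obj X) :=
      Triangle.coyoneda_exact₃ _ (LeftMutation.distinguished a (τ.obj X)) f h₁
    obtain ⟨g, rfl⟩ : ∃ g' : (iterate τ i).obj A ⟶ X, τ.map g' = g := τ.map_surjective g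
    rw [(residual_iff τ a X).1 hX i (by omega) A hA g, Functor.map_zero]
    exact zero_comp

end Residual

/-! ### Serre functors from duality isomorphisms -/

section Duality

variable {k : Type w} [Field k] {C : Type u} [Category.{v} C] [Preadditive C] [Linear k C]
  (F : C ⥤ C) (d : ∀ X Y : C, (X ⟶ Y) ≃ₗ[k] Module.Dual k (Y ⟶ F.obj X))

/-- The functional dual to `h` is g ↦ d(𝟙)(g ≫ F h), so `F h` determines `h`. -/
lemma faithful_of_duality (hl : ∀ {X' X Y : C} (h : X' ⟶ X) (f : X ⟶ Y) (g : Y ⟶ F.obj X'),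
    d X' Y (h ≫ f) g = d X Y f (g ≫ F.map h)) : F.Faithful where
  map_injective {X' X} h h' hh := (d X' X).injective (LinearMap.ext fun g => by
    rw [← Category.comp_id h, ← Category.comp_id h', hl, hl, hh])

/-- A preimage of `φ` is the morphism whose dual functional is g ↦ d(𝟙)(g ≫ φ). No
finite-dimensionality is needed, since functionals separate vectors over a field and each of them
comes from a morphism. -/
lemma full_of_duality
    (hr : ∀ {X Y Y' : C} (f : X ⟶ Y) (h : Y ⟶ Y') (g : Y' ⟶ F.obj X),
      d X Y' (f ≫ h) g = d X Y f (h ≫ g))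
    (hl : ∀ {X' X Y : C} (h : X' ⟶ X) (f : X ⟶ Y) (g : Y ⟶ F.obj X'),
      d X' Y (h ≫ f) g = d X Y f (g ≫ F.map h)) : F.Full where
  map_surjective {X' X} φ := by
    let h : X' ⟶ X := (d X' X).symm ((d X X (𝟙 X)).comp (Linear.rightComp k X φ))
    have hh : ∀ g, d X X (𝟙 X) (g ≫ F.map h) = d X X (𝟙 X) (g ≫ φ) := fun g => by
      rw [← hl, Category.comp_id]
      simp [h]
    refine ⟨h, sub_eq_zero.1 ((Module.forall_dual_apply_eq_zero_iff k _).1 fun ξ => ?_)⟩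
    obtain ⟨f, rfl⟩ := (d X _).surjective ξ
    rw [← Category.id_comp f, hr, Preadditive.comp_sub, map_sub, hh, sub_self]

/-- If `U f` is invertible, then by adjunction precomposition with `f` is bijective on maps to every
`F X`. Its dual is postcomposition with `f` on maps from X, so Yoneda applies. -/
lemma reflectsIsomorphisms_of_duality
    (hr : ∀ {X Y Y' : C} (f : X ⟶ Y) (h : Y ⟶ Y') (g : Y' ⟶ F.obj X),
      d X Y' (f ≫ h) g = d X Y f (h ≫ g)) {U : C ⥤ C} (adj : U ⊣ F) :
    U.ReflectsIsomorphisms where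
  reflects {Y Z} f hf := by
    refine isIso_of_yoneda_map_bijective f fun X => ?_
    let p : (Z ⟶ F.obj X) →ₗ[k] (Y ⟶ F.obj X) := Linear.leftComp k (F.obj X) f
    have hp : Function.Bijective p := by
      have h : p = (adj.homEquiv Y X) ∘ (fun g => U.map f ≫ g) ∘ (adj.homEquiv Z X).symm := by
        funext g
        change f ≫ g = adj.homEquiv Y X (U.map f ≫ (adj.homEquiv Z X).symm g)
        rw [adj.homEquiv_naturality_left, Equiv.apply_symm_apply]
      rw [h]
      exact (adj.homEquiv Y X).bijective.comp
        (((isIso_iff_coyoneda_map_bijective (U.map f)).1 hf X).comp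
          (adj.homEquiv Z X).symm.bijective)
    have h : (fun g : X ⟶ Y => g ≫ f) = (d X Z).symm ∘ p.dualMap ∘ d X Y := by
      funext g
      apply (d X Z).injective
      rw [Function.comp_apply, LinearEquiv.apply_symm_apply]
      exact LinearMap.ext fun l => hr g f l
    rw [h]
    exact (d X Z).symm.bijective.comp
      ((LinearMap.dualMap_bijective_iff.2 hp).comp (d X Y).bijective)

/-- A Serre functor from an adjunction and dualities. -/
noncomputable def SerreFunctor.ofAdjunction
    (hr : ∀ {X Y Y' : C} (f : X ⟶ Y) (h : Y ⟶ Y') (g : Y' ⟶ F.obj X),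
      d X Y' (f ≫ h) g = d X Y f (h ≫ g))
    (hl : ∀ {X' X Y : C} (h : X' ⟶ X) (f : X ⟶ Y) (g : Y ⟶ F.obj X'),
      d X' Y (h ≫ f) g = d X Y f (g ≫ F.map h)) {U : C ⥤ C} (adj : U ⊣ F) :
    SerreFunctor k C :=
  haveI := faithful_of_duality F d hl
  haveI := full_of_duality F d hr hl
  haveI := reflectsIsomorphisms_of_duality F d hr adj
  -- The counit is invertible as `F` is fully faithful, so a triangle identity shows that `U`
  -- inverts the unit; and `U` reflects isomorphisms.
  haveI : ∀ X, IsIso (adj.unit.app X) := fun X => by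
    have : IsIso (U.map (adj.unit.app X)) := by
      rw [(IsIso.eq_comp_inv (adj.counit.app (U.obj X))).2 (adj.left_triangle_components X),
        Category.id_comp]
      infer_instance
    exact isIso_of_reflects_iso _ U
  { S := adj.toEquivalence.symm
    duality := d
    naturality_right := hr
    naturality_left := hl }

end Duality

/-! ### Restricting a Serre functor to a full subcategory -/

section Restriction

variable {k : Type w} [Field k] {T : Type u} [Category.{v} T] [Preadditive T] [Linear k T]
  (S : SerreFunctor k T) (R : ObjectProperty T)

/-- Every object `S(X)` with `X` in `R` has a universal morphism from an object of `R`. -/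
def HasSerreCoreflections : Prop :=
  ∀ X : R.FullSubcategory, ∃ (r : R.FullSubcategory) (c : r.obj ⟶ S.S.functor.obj X.obj),
    ∀ G : R.FullSubcategory, Function.Bijective fun g : G.obj ⟶ r.obj => g ≫ c

namespace HasSerreCoreflections

variable {S R} (hc : HasSerreCoreflections S R)

/-- The object of `R` with a universal morphism to `S(X)`. -/
noncomputable def obj (X : R.FullSubcategory) : R.FullSubcategory := (hc X).choose

/-- The universal morphism to `S(X)`. -/
noncomputable def counit (X : R.FullSubcategory) : (hc.obj X).obj ⟶ S.S.functor.obj X.obj :=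
  (hc X).choose_spec.choose

lemma bijective_comp_counit (Y X : R.FullSubcategory) :
    Function.Bijective fun g : Y ⟶ hc.obj X => g.hom ≫ hc.counit X :=
  ((hc X).choose_spec.choose_spec Y).comp R.fullyFaithfulι.homEquiv.bijective

/-- Morphisms to `S(X)` factor uniquely through the universal one. -/
noncomputable def objHomEquiv (Y X : R.FullSubcategory) :
    (Y ⟶ hc.obj X) ≃ₗ[k] (Y.obj ⟶ S.S.functor.obj X.obj) :=
  LinearEquiv.ofBijective
    { toFun := fun g => g.hom ≫ hc.counit X
      map_add' := fun g g' => Preadditive.add_comp _ _ _ g.hom g'.hom _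
      map_smul' := fun r g => Linear.smul_comp _ _ _ r g.hom _ }
    (hc.bijective_comp_counit Y X)

lemma objHomEquiv_apply {Y X : R.FullSubcategory} (g : Y ⟶ hc.obj X) :
    hc.objHomEquiv Y X g = g.hom ≫ hc.counit X := rfl

lemma objHomEquiv_comp {Y Y' X : R.FullSubcategory} (f : Y' ⟶ Y) (g : Y ⟶ hc.obj X) :
    hc.objHomEquiv Y' X (f ≫ g) = f.hom ≫ hc.objHomEquiv Y X g := Category.assoc _ _ _

/-- The functor sending `X` to the universal object over `S(X)`. -/
noncomputable def functor : R.FullSubcategory ⥤ R.FullSubcategory where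
  obj := hc.obj
  map {X X'} h := (hc.objHomEquiv _ X').symm (hc.counit X ≫ S.S.functor.map h.hom)
  map_id X := by
    rw [LinearEquiv.symm_apply_eq, objHomEquiv_apply]
    simp
  map_comp {X X' X''} h h' := by
    rw [LinearEquiv.symm_apply_eq, objHomEquiv_comp, LinearEquiv.apply_symm_apply,
      ← Category.assoc, ← objHomEquiv_apply, LinearEquiv.apply_symm_apply]
    simp

/-- Morphisms to `S(X)` from objects of `R` correspond to morphisms to the universal object. -/
noncomputable def homEquiv (Y X : R.FullSubcategory) :
    (Y ⟶ hc.functor.obj X) ≃ₗ[k] (Y.obj ⟶ S.S.functor.obj X.obj) :=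
  hc.objHomEquiv Y X

lemma homEquiv_comp {Y Y' X : R.FullSubcategory} (f : Y' ⟶ Y) (g : Y ⟶ hc.functor.obj X) :
    hc.homEquiv Y' X (f ≫ g) = f.hom ≫ hc.homEquiv Y X g := hc.objHomEquiv_comp f g

lemma homEquiv_comp_map {Y X X' : R.FullSubcategory} (g : Y ⟶ hc.functor.obj X) (h : X ⟶ X') :
    hc.homEquiv Y X' (g ≫ hc.functor.map h) = hc.homEquiv Y X g ≫ S.S.functor.map h.hom := by
  rw [homEquiv_comp]
  exact (congrArg (g.hom ≫ ·) ((hc.objHomEquiv (hc.obj X) X').apply_symm_apply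
    (hc.counit X ≫ S.S.functor.map h.hom))).trans (Category.assoc _ _ _).symm

/-- The duality isomorphisms on `R`. -/
noncomputable def duality (X Y : R.FullSubcategory) :
    (X ⟶ Y) ≃ₗ[k] Module.Dual k (Y ⟶ hc.functor.obj X) :=
  (({ R.fullyFaithfulι.homEquiv with
      map_add' _ _ := rfl
      map_smul' _ _ := rfl } : (X ⟶ Y) ≃ₗ[k] (X.obj ⟶ Y.obj)).trans
    (S.duality X.obj Y.obj)).trans (hc.homEquiv Y X).dualMap

lemma duality_apply {X Y : R.FullSubcategory} (f : X ⟶ Y) (g : Y ⟶ hc.functor.obj X) :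
    hc.duality X Y f g = S.duality X.obj Y.obj f.hom (hc.homEquiv Y X g) := rfl

section

variable {U : R.FullSubcategory ⥤ R.FullSubcategory} (ψ : R.ι ⋙ S.S.inverse ⟶ U ⋙ R.ι)
  (hψ : ∀ Y X : R.FullSubcategory,
    Function.Bijective fun g : (U.obj Y).obj ⟶ X.obj => ψ.app Y ≫ g)

/-- The bijections of the adjunction between a left adjoint of `S⁻¹` and `functor`. -/
noncomputable def adjHomEquiv (Y X : R.FullSubcategory) :
    (U.obj Y ⟶ X) ≃ (Y ⟶ hc.functor.obj X) :=
  ((R.fullyFaithfulι.homEquiv.trans (Equiv.ofBijective _ (hψ Y X))).trans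
    (S.S.symm.toAdjunction.homEquiv Y.obj X.obj)).trans (hc.homEquiv Y X).toEquiv.symm

lemma homEquiv_adjHomEquiv {Y X : R.FullSubcategory} (g : U.obj Y ⟶ X) :
    hc.homEquiv Y X (hc.adjHomEquiv ψ hψ Y X g) =
      S.S.symm.toAdjunction.homEquiv Y.obj X.obj (ψ.app Y ≫ g.hom) :=
  (hc.homEquiv Y X).apply_symm_apply _

/-- A functor `U` on `R` that corepresents `Hom(S⁻¹(Y), -)` is left adjoint to `functor`. -/
noncomputable def adjunction : U ⊣ hc.functor :=
  Adjunction.mkOfHomEquiv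
    { homEquiv := hc.adjHomEquiv ψ hψ
      homEquiv_naturality_left_symm {Y' Y X} f g := by
        rw [Equiv.symm_apply_eq]
        obtain ⟨g, rfl⟩ := (hc.adjHomEquiv ψ hψ Y X).surjective g
        rw [Equiv.symm_apply_apply]
        apply (hc.homEquiv Y' X).injective
        have h := ψ.naturality f
        refine (hc.homEquiv_comp _ _).trans ?_
        rw [homEquiv_adjHomEquiv, homEquiv_adjHomEquiv,
          ← Adjunction.homEquiv_naturality_left]
        congr 1
        refine (Category.assoc _ _ _).symm.trans ((congrArg (· ≫ g.hom) h).trans ?_)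
        exact Category.assoc _ _ _
      homEquiv_naturality_right {Y X X'} g h := by
        apply (hc.homEquiv Y X').injective
        rw [homEquiv_adjHomEquiv, homEquiv_comp_map, homEquiv_adjHomEquiv]
        refine Eq.trans ?_ (Adjunction.homEquiv_naturality_right _ _ _)
        congr 1
        exact (Category.assoc _ _ _).symm }

/-- The Serre functor of `R`. -/
noncomputable def serreFunctor : SerreFunctor k R.FullSubcategory :=
  SerreFunctor.ofAdjunction hc.functor hc.duality
    (fun f h g => by
      rw [duality_apply, duality_apply, homEquiv_comp]
      exact S.naturality_right _ _ _)
    (fun h f g => by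
      rw [duality_apply, duality_apply, homEquiv_comp_map]
      exact S.naturality_left _ _ _)
    (hc.adjunction ψ hψ)

end

end HasSerreCoreflections

end Restriction

/-! ### Coreflections onto a right orthogonal by Serre duality -/

section Coreflections

variable {k : Type w} [Field k] {T : Type u} [Category.{v} T] [Preadditive T] [Linear k T]
  [HasZeroObject T] [HasShift T ℤ] [∀ n : ℤ, (shiftFunctor T n).Additive] [Pretriangulated T]
  (S : SerreFunctor k T) {D : ObjectProperty T} [D.IsTriangulated]

lemma bijective_precomp_of_trW {X Y : T} {f : X ⟶ Y} (hf : D.trW f) {G : T}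
    (hG : D.rightOrthogonal G) : Function.Bijective fun g : Y ⟶ G => f ≫ g := by
  rw [← ObjectProperty.isLocal_trW] at hG
  exact hG f hf

include S in
-- Every object is isomorphic to some S(X). If l → X is the coreflection in `^⊥D`, then S(l) lies in
-- `D^⊥` by duality. For G in `D^⊥`, the map Hom(G, S(l)) → Hom(G, S(X)) has as dual Hom(X, G) →
-- Hom(l, G), bijective because the cone of l → X is in `D`.
lemma exists_rightOrthogonal_coreflection (hD : HasCoreflections D) (Z : T) :
    ∃ (r : T) (_ : D.rightOrthogonal r) (c : r ⟶ Z),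
      ∀ G : T, D.rightOrthogonal G → Function.Bijective fun g : G ⟶ r => g ≫ c := by
  suffices h : ∀ X : T, ∃ (r : T) (_ : D.rightOrthogonal r) (c : r ⟶ S.S.functor.obj X),
      ∀ G : T, D.rightOrthogonal G → Function.Bijective fun g : G ⟶ r => g ≫ c by
    obtain ⟨r, hr, c, hc⟩ := h (S.S.functor.objPreimage Z)
    let e := S.S.functor.objObjPreimageIso Z
    refine ⟨r, hr, c ≫ e.hom, fun G hG => ?_⟩
    have : (fun g : G ⟶ r => g ≫ c ≫ e.hom) = (fun g => g ≫ e.hom) ∘ fun g => g ≫ c := by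
      funext g
      simp
    rw [this]
    exact ((isIso_iff_yoneda_map_bijective e.hom).1 inferInstance G).comp (hc G hG)
  intro X
  obtain ⟨l, f, hf, hl⟩ := hD X
  refine ⟨S.S.functor.obj l, fun A g hA => ?_, S.S.functor.map f, fun G hG => ?_⟩
  · refine (Module.forall_dual_apply_eq_zero_iff k g).1 fun ξ => ?_
    obtain ⟨h, rfl⟩ := (S.duality l A).surjective ξ
    rw [hl h hA, map_zero, LinearMap.zero_apply]
  · let p : (G ⟶ S.S.functor.obj l) →ₗ[k] (G ⟶ S.S.functor.obj X) :=
      Linear.rightComp k G (S.S.functor.map f)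
    have h : p.dualMap = S.duality l G ∘ (fun g => f ≫ g) ∘ (S.duality X G).symm := by
      funext ξ
      obtain ⟨h, rfl⟩ := (S.duality X G).surjective ξ
      rw [Function.comp_apply, Function.comp_apply, LinearEquiv.symm_apply_apply]
      exact LinearMap.ext fun g => (S.naturality_left f h g).symm
    refine (LinearMap.dualMap_bijective_iff (f := p)).1 ?_
    rw [h]
    exact (S.duality l G).bijective.comp
      ((bijective_precomp_of_trW hf hG).comp (S.duality X G).symm.bijective)

lemma hasSerreCoreflections_of_hasCoreflections (hD : HasCoreflections D) :
    HasSerreCoreflections S D.rightOrthogonal := fun X => by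
  obtain ⟨r, hr, c, hc⟩ := exists_rightOrthogonal_coreflection S hD (S.S.functor.obj X.obj)
  exact ⟨⟨r, hr⟩, c, fun G => hc G.obj G.property⟩

end Coreflections

/-! ### The Serre functor of the residual category -/

section ResidualSerre

variable {k : Type w} [Field k] {T : Type u} [Category.{v} T] [Preadditive T] [Linear k T]
  [HasZeroObject T] [HasShift T ℤ] [∀ n : ℤ, (shiftFunctor T n).Additive] [Pretriangulated T]
  [IsTriangulated T] {τ : T ⥤ T} [τ.CommShift ℤ] [τ.IsTriangulated]
  {a : ObjectProperty T} [IsAdmissible a] {m : ℕ}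

variable (h : ∀ X : (residual τ m a).FullSubcategory,
  residual τ m a (((residual τ m a).ι ⋙ τ ⋙ leftMutation a).obj X))
  (S : SerreFunctor k T) (s : ℤ) (σ : iterate τ m ≅ S.S.inverse ⋙ shiftFunctor T s)

/-- The inverse Serre functor of the residual category. -/
noncomputable abbrev residualSerreInverse :
    (residual τ m a).FullSubcategory ⥤ (residual τ m a).FullSubcategory :=
  iterate (residualPolarization h) m ⋙ shiftFunctor _ (-s)

/-- The natural transformation from the inverse Serre functor to that of the residual category. -/
noncomputable def serreInverseTrans : (residual τ m a).ι ⋙ S.S.inverse ⟶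
    residualSerreInverse h s ⋙ (residual τ m a).ι :=
  -- The composite S⁻¹ ≅ S⁻¹[s][-s] ≅ τ^m[-s] → τ_R^m[-s].
  (Functor.whiskerLeft ((residual τ m a).ι ⋙ S.S.inverse)
    (shiftFunctorCompIsoId T s (-s) (add_neg_cancel s)).inv ≫
  Functor.whiskerRight (Functor.whiskerLeft (residual τ m a).ι σ.inv) (shiftFunctor T (-s))) ≫
  Functor.whiskerRight (iterateTrans h m) (shiftFunctor T (-s)) ≫
  Functor.whiskerLeft (iterate (residualPolarization h) m)
    ((residual τ m a).ι.commShiftIso (-s)).inv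

lemma trW_serreInverseTrans (Y : (residual τ m a).FullSubcategory) :
    (iterateHull τ a m).trW ((serreInverseTrans h S s σ).app Y) := by
  have h₁ := (trW_iterateTrans h m Y).shift (-s)
  have h₂ : (iterateHull τ a m).trW
      ((shiftFunctorCompIsoId T s (-s) (add_neg_cancel s)).inv.app (S.S.inverse.obj Y.obj) ≫
        (shiftFunctor T (-s)).map (σ.inv.app Y.obj)) := ObjectProperty.trW_of_isIso _ _
  have h₃ : (iterateHull τ a m).trW (((residual τ m a).ι.commShiftIso (-s)).inv.app
      ((iterate (residualPolarization h) m).obj Y)) := ObjectProperty.trW_of_isIso _ _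
  exact (iterateHull τ a m).trW.comp_mem _ _ h₂ ((iterateHull τ a m).trW.comp_mem _ _ h₁ h₃)

variable [τ.IsEquivalence]

lemma IsPrimitive.hasReflections (ha : IsPrimitive τ m a) : HasReflections (iterateHull τ a m) :=
  hasReflections_hull ha.isSemiorthogonal
    fun i => (IsAdmissible.hasReflections a).map (iterate τ i)

lemma IsPrimitive.hasCoreflections (ha : IsPrimitive τ m a) :
    HasCoreflections (iterateHull τ a m) :=
  hasCoreflections_hull ha.isSemiorthogonal
    fun i => (IsAdmissible.hasCoreflections a).map (iterate τ i)

include S σ in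
-- As S⁻¹ → τ_R^m[-s] has cone in the hull, τ_R^m[-s] corepresents Hom(S⁻¹(Y), -) on the residual
-- category; it is thus left adjoint, and then inverse, to the restricted Serre functor.
lemma IsPrimitive.isPolarization (ha : IsPrimitive τ m a) (hm : 0 < m) (hτ : τ.Linear k) :
    IsPolarization k (residualPolarization h) m := by
  have hc := hasSerreCoreflections_of_hasCoreflections S ha.hasCoreflections
  let S' := hc.serreFunctor (serreInverseTrans h S s σ) fun Y X =>
    bijective_precomp_of_trW (trW_serreInverseTrans h S s σ Y) X.property
  -- `SerreFunctor.ofAdjunction` takes the given left adjoint itself as the inverse, so the equality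
  -- is definitional; `e` relies on the same fact.
  have hS' : S'.S.inverse = residualSerreInverse h s := rfl
  let e : iterate (residualPolarization h) m ≅ S'.S.inverse ⋙ shiftFunctor _ s :=
    Functor.isoWhiskerLeft (iterate (residualPolarization h) m)
      (shiftFunctorCompIsoId _ (-s) s (neg_add_cancel s)).symm
  refine ⟨hm, ⟨?_, ⟨fun f r => ?_⟩, ⟨inferInstance, inferInstance⟩⟩, S', s, ⟨e⟩⟩
  · obtain ⟨n, rfl⟩ : ∃ n, m = n + 1 := ⟨m - 1, by omega⟩
    exact isEquivalence_of_iterate _ n (Functor.isEquivalence_of_iso e.symm)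
  · ext
    change (leftMutation a).map (τ.map (r • f.hom)) = r • (leftMutation a).map (τ.map f.hom)
    rw [τ.map_smul, LeftMutation.leftMutation_map_smul]

end ResidualSerre

section IdempotentComplete

lemma isIdempotentComplete_rightOrthogonal {T : Type u} [Category.{v} T] [Preadditive T]
    (hT : IsIdempotentComplete T) (D : ObjectProperty T) :
    IsIdempotentComplete D.rightOrthogonal.FullSubcategory where
  idempotents_split X p hp := by
    obtain ⟨Y, i, e, hie, hei⟩ := hT.idempotents_split X.obj p.hom
      (congrArg InducedCategory.Hom.hom hp)
    refine ⟨⟨Y, fun G g hG => ?_⟩, ObjectProperty.homMk i, ObjectProperty.homMk e, ?_, ?_⟩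
    · rw [← Category.comp_id g, ← hie, ← Category.assoc, X.property (g ≫ i) hG, zero_comp]
    · ext
      exact hie
    · ext
      exact hei

end IdempotentComplete

section Shift

variable {k : Type w} [Field k] {T : Type u} [Category.{v} T] [HasShift T ℤ]

/-- Moving the shift to `G` reduces to the universal property of `c`. All shifts are needed because
a quasi-isomorphism is tested in every degree. -/
lemma bijective_comp_shift {R : ObjectProperty T} [R.IsStableUnderShift ℤ] {r Z : T} (c : r ⟶ Z)
    (h : ∀ G, R G → Function.Bijective fun g : G ⟶ r => g ≫ c) {G : T} (hG : R G) (n : ℤ) :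
    Function.Bijective fun g : G ⟶ r⟦n⟧ => g ≫ c⟦n⟧' := by
  let adj := (shiftEquiv T n).symm.toAdjunction
  have : (fun g : G ⟶ r⟦n⟧ => g ≫ c⟦n⟧') =
      adj.homEquiv G Z ∘ (fun g => g ≫ c) ∘ (adj.homEquiv G r).symm := by
    funext g
    obtain ⟨g, rfl⟩ := (adj.homEquiv G r).surjective g
    rw [Function.comp_apply, Function.comp_apply, Equiv.symm_apply_apply,
      adj.homEquiv_naturality_right]
    rfl
  rw [this]
  exact (adj.homEquiv G Z).bijective.comp ((h _ (R.le_shift (-n) _ hG)).comp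
    (adj.homEquiv G r).symm.bijective)

variable [Preadditive T] [Linear k T]

/-- Shifted morphisms in a full subcategory are those of the ambient category. -/
noncomputable def shiftedHomEquiv (R : ObjectProperty T) [R.IsStableUnderShift ℤ]
    (X Y : R.FullSubcategory) (n : ℤ) :
    ShiftedHom X Y n ≃ₗ[k] ShiftedHom X.obj Y.obj n :=
  LinearEquiv.ofBijective
    { toFun := fun f => ShiftedHom.map f R.ι
      map_add' := fun f g => Preadditive.add_comp _ _ _ f.hom g.hom _
      map_smul' := fun r f => Linear.smul_comp _ _ _ r f.hom _ }
    (((isIso_iff_yoneda_map_bijective ((R.ι.commShiftIso n).hom.app Y)).1 inferInstance _).comp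
      R.fullyFaithfulι.homEquiv.bijective)

lemma shiftedHomEquiv_apply (R : ObjectProperty T) [R.IsStableUnderShift ℤ]
    {X Y : R.FullSubcategory} {n : ℤ} (f : ShiftedHom X Y n) :
    shiftedHomEquiv (k := k) R X Y n f = ShiftedHom.map f R.ι := rfl

end Shift

/-! ### Enhancing a right orthogonal by a full dg subcategory -/

section Enhancement

variable {k : Type w} [Field k] {T : Type u} [Category.{v} T] [Preadditive T] [Linear k T]
  [HasZeroObject T] [HasShift T ℤ] [∀ n : ℤ, (shiftFunctor T n).Additive] [Pretriangulated T]

namespace DGEnhancement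

variable (E : DGEnhancement k T)

/-- `E.map n` identifies the n-th cohomology with shifted morphisms in T and respects composition,
so the hypothesis says that the map is bijective on cohomology. -/
lemma quasiIso_postcomp {a' a : E.A.Obj} (u : E.A.Z a' a 0) (x : E.A.Obj)
    (h : ∀ n : ℤ, Function.Bijective fun f : ShiftedHom (E.obj x) (E.obj a') n =>
      f.comp (E.map 0 u) (zero_add n)) : QuasiIso (DGCategory.postcomp u x) := by
  have hmap : ∀ (n : ℤ) (f : E.A.Z x a' n) (g : E.A.Z x a n),
      g.1 = ((DGCategory.postcomp u x).f n).hom f.1 →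
      E.map n g = (E.map n f).comp (E.map 0 u) (zero_add n) :=
    fun n f g hg => E.map_comp (zero_add n) u f g hg
  have hcl : ∀ (n : ℤ) (f : E.A.Z x a' n),
      ((E.A.Hom x a).d n (n + 1)).hom (((DGCategory.postcomp u x).f n).hom f.1) = 0 :=
    fun n f => by
      rw [← Tot.f_d_apply, LinearMap.mem_ker.1 f.2, map_zero]
  refine quasiIso_of_cocycles _ (fun n f hf w hw => ?_) (fun n y hy => ?_)
  · let f' : E.A.Z x a' n := ⟨f, LinearMap.mem_ker.2 hf⟩
    refine (E.map_eq_zero_iff n f').1 ((h n).1 ?_)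
    change (E.map n f').comp (E.map 0 u) (zero_add n) = ShiftedHom.comp 0 (E.map 0 u) (zero_add n)
    rw [ShiftedHom.zero_comp, ← hmap n f' ⟨_, LinearMap.mem_ker.2 (hcl n f')⟩ rfl,
      E.map_eq_zero_iff]
    exact ⟨w, hw⟩
  · let y' : E.A.Z x a n := ⟨y, LinearMap.mem_ker.2 hy⟩
    obtain ⟨φ, hφ⟩ := (h n).2 (E.map n y')
    obtain ⟨f, rfl⟩ := E.map_surjective n φ
    refine ⟨f.1, LinearMap.mem_ker.1 f.2, ?_⟩
    let g : E.A.Z x a n := ⟨_, LinearMap.mem_ker.2 (hcl n f)⟩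
    refine (E.map_eq_zero_iff n (g - y')).1 ?_
    rw [map_sub, hmap n f g rfl, sub_eq_zero]
    exact hφ

lemma quasiIso_precomp {b b' : E.A.Obj} (u : E.A.Z b b' 0) (y : E.A.Obj)
    (h : ∀ n : ℤ, Function.Bijective fun f : ShiftedHom (E.obj b') (E.obj y) n =>
      (E.map 0 u).comp f (add_zero n)) : QuasiIso (DGCategory.precomp u y) := by
  have hmap : ∀ (n : ℤ) (f : E.A.Z b' y n) (g : E.A.Z b y n),
      g.1 = ((DGCategory.precomp u y).f n).hom f.1 →
      E.map n g = (E.map 0 u).comp (E.map n f) (add_zero n) :=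
    fun n f g hg => E.map_comp (add_zero n) f u g hg
  have hcl : ∀ (n : ℤ) (f : E.A.Z b' y n),
      ((E.A.Hom b y).d n (n + 1)).hom (((DGCategory.precomp u y).f n).hom f.1) = 0 :=
    fun n f => by
      rw [← Tot.f_d_apply, LinearMap.mem_ker.1 f.2, map_zero]
  refine quasiIso_of_cocycles _ (fun n f hf w hw => ?_) (fun n z hz => ?_)
  · let f' : E.A.Z b' y n := ⟨f, LinearMap.mem_ker.2 hf⟩
    refine (E.map_eq_zero_iff n f').1 ((h n).1 ?_)
    change (E.map 0 u).comp (E.map n f') (add_zero n) = ShiftedHom.comp (E.map 0 u) 0 (add_zero n)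
    rw [ShiftedHom.comp_zero, ← hmap n f' ⟨_, LinearMap.mem_ker.2 (hcl n f')⟩ rfl,
      E.map_eq_zero_iff]
    exact ⟨w, hw⟩
  · let z' : E.A.Z b y n := ⟨z, LinearMap.mem_ker.2 hz⟩
    obtain ⟨φ, hφ⟩ := (h n).2 (E.map n z')
    obtain ⟨f, rfl⟩ := E.map_surjective n φ
    refine ⟨f.1, LinearMap.mem_ker.1 f.2, ?_⟩
    let g : E.A.Z b y n := ⟨_, LinearMap.mem_ker.2 (hcl n f)⟩
    refine (E.map_eq_zero_iff n (g - z')).1 ?_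
    rw [map_sub, hmap n f g rfl, sub_eq_zero]
    exact hφ

lemma exists_closed_map {x y : E.A.Obj} (c : E.obj x ⟶ E.obj y) :
    ∃ u : E.A.Z x y 0, E.map 0 u = ShiftedHom.mk₀ 0 rfl c :=
  E.map_surjective 0 _

variable {E}

lemma exists_quasiIso_postcomp {R : ObjectProperty T} [R.IsStableUnderShift ℤ]
    [R.IsClosedUnderIsomorphisms] (hR : ∀ Z : T, ∃ (r : T) (_ : R r) (c : r ⟶ Z),
      ∀ G : T, R G → Function.Bijective fun g : G ⟶ r => g ≫ c) (a : E.A.Obj) :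
    ∃ (a' : E.A.Obj) (_ : R (E.obj a')) (u : E.A.Z a' a 0),
      ∀ x, R (E.obj x) → QuasiIso (DGCategory.postcomp u x) := by
  obtain ⟨r, hr, c, hc⟩ := hR (E.obj a)
  obtain ⟨a', ⟨e⟩⟩ := E.essSurj r
  obtain ⟨u, hu⟩ := E.exists_closed_map (e.hom ≫ c)
  refine ⟨a', R.prop_of_iso e.symm hr, u, fun x hx => E.quasiIso_postcomp u x fun n => ?_⟩
  rw [hu]
  simp only [ShiftedHom.comp_mk₀]
  refine bijective_comp_shift (e.hom ≫ c) (fun G hG => ?_) hx n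
  have : (fun g : G ⟶ E.obj a' => g ≫ e.hom ≫ c) = (fun g => g ≫ c) ∘ fun g => g ≫ e.hom := by
    funext g
    simp
  rw [this]
  exact (hc G hG).comp ((isIso_iff_yoneda_map_bijective e.hom).1 inferInstance G)

lemma exists_quasiIso_precomp {R : ObjectProperty T} [R.IsStableUnderShift ℤ]
    [R.IsClosedUnderIsomorphisms] (hR : ∀ Z : T, ∃ (r : T) (_ : R r) (c : Z ⟶ r),
      ∀ G : T, R G → Function.Bijective fun g : r ⟶ G => c ≫ g) (b : E.A.Obj) :
    ∃ (b' : E.A.Obj) (_ : R (E.obj b')) (u : E.A.Z b b' 0),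
      ∀ y, R (E.obj y) → QuasiIso (DGCategory.precomp u y) := by
  obtain ⟨r, hr, c, hc⟩ := hR (E.obj b)
  obtain ⟨b', ⟨e⟩⟩ := E.essSurj r
  obtain ⟨u, hu⟩ := E.exists_closed_map (c ≫ e.inv)
  refine ⟨b', R.prop_of_iso e.symm hr, u, fun y hy => E.quasiIso_precomp u y fun n => ?_⟩
  rw [hu]
  simp only [ShiftedHom.mk₀_comp]
  have : (fun g : E.obj b' ⟶ (E.obj y)⟦n⟧ => (c ≫ e.inv) ≫ g) =
      (fun g => c ≫ g) ∘ fun g => e.inv ≫ g := by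
    funext g
    simp
  rw [this]
  exact (hc _ (R.le_shift n _ hy)).comp
    ((isIso_iff_coyoneda_map_bijective e.inv).1 inferInstance _)

end DGEnhancement

section Restrict

variable (E : DGEnhancement k T) (D : ObjectProperty T) [D.IsTriangulated]

/-- The identity of `y` factors, in shifted degrees, through `x`, so every map G → `E.obj y` factors
through a map from G to a shift of `E.obj x`, which is zero. -/
lemma DGEnhancement.rightOrthogonal_of_isShift {x y : E.A.Obj} {n : ℤ}
    (h : DGCategory.IsShift n x y) (hx : D.rightOrthogonal (E.obj x)) :
    D.rightOrthogonal (E.obj y) := fun G g hG => by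
  obtain ⟨σ, σ', -, h⟩ := h
  have hone : E.A.one y ∈ E.A.Z y y 0 := LinearMap.mem_ker.2 (E.A.d_one y)
  have h₁ := E.map_comp (add_neg_cancel n) σ σ' ⟨_, hone⟩ h.symm
  rw [E.map_one y _ rfl] at h₁
  have h₂ : (ShiftedHom.mk₀ (0 : ℤ) rfl g).comp (E.map (-n) σ') (add_zero (-n)) = 0 :=
    D.rightOrthogonal.le_shift (-n) _ hx _ hG
  have h₃ : ShiftedHom.mk₀ (0 : ℤ) rfl g = 0 := by
    rw [← ShiftedHom.comp_mk₀_id (ShiftedHom.mk₀ (0 : ℤ) rfl g) 0 rfl, h₁,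
      ← ShiftedHom.comp_assoc _ _ _ (add_zero (-n)) (add_neg_cancel n) (by omega), h₂,
      ShiftedHom.zero_comp]
  exact (ShiftedHom.homEquiv (0 : ℤ) rfl).injective
    (h₃.trans (ShiftedHom.mk₀_zero _ _ (0 : ℤ) rfl).symm)

/-- The restriction of a dg enhancement to a right orthogonal subcategory. -/
noncomputable def DGEnhancement.restrict : DGEnhancement k D.rightOrthogonal.FullSubcategory where
  A := E.A.full fun x => D.rightOrthogonal (E.obj x)
  obj x := ⟨E.obj x.1, x.2⟩
  essSurj X := by
    obtain ⟨x, ⟨e⟩⟩ := E.essSurj X.obj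
    exact ⟨⟨x, D.rightOrthogonal.prop_of_iso e.symm X.property⟩, ⟨D.rightOrthogonal.isoMk e⟩⟩
  map {x y} n := (shiftedHomEquiv (k := k) D.rightOrthogonal ⟨E.obj x.1, x.2⟩ ⟨E.obj y.1, y.2⟩
    n).symm.toLinearMap.comp (E.map (x := x.1) (y := y.1) n)
  map_surjective {x y} n := (shiftedHomEquiv (k := k) D.rightOrthogonal ⟨E.obj x.1, x.2⟩
    ⟨E.obj y.1, y.2⟩ n).symm.surjective.comp (E.map_surjective (x := x.1) (y := y.1) n)
  map_eq_zero_iff {x y} n f := (shiftedHomEquiv (k := k) D.rightOrthogonal ⟨E.obj x.1, x.2⟩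
    ⟨E.obj y.1, y.2⟩ n).symm.map_eq_zero_iff.trans (E.map_eq_zero_iff (x := x.1) (y := y.1) n f)
  map_one x e he := by
    refine (LinearEquiv.symm_apply_eq _).2 ?_
    rw [shiftedHomEquiv_apply, ShiftedHom.map_mk₀]
    exact E.map_one x.1 e he
  map_comp {x y z q p n} h g f gf hgf := by
    refine (LinearEquiv.symm_apply_eq _).2 ?_
    rw [shiftedHomEquiv_apply, ShiftedHom.map_comp]
    refine (E.map_comp h g f gf hgf).trans ?_
    have h₁ := (shiftedHomEquiv (k := k) D.rightOrthogonal ⟨E.obj x.1, x.2⟩ ⟨E.obj y.1, y.2⟩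
      p).apply_symm_apply (E.map (x := x.1) (y := y.1) p f)
    have h₂ := (shiftedHomEquiv (k := k) D.rightOrthogonal ⟨E.obj y.1, y.2⟩ ⟨E.obj z.1, z.2⟩
      q).apply_symm_apply (E.map (x := y.1) (y := z.1) q g)
    exact congrArg₂ (fun a b => ShiftedHom.comp a b h) h₁.symm h₂.symm
  exists_shift x n := by
    obtain ⟨y, hy⟩ := E.exists_shift x.1 n
    exact ⟨⟨y, E.rightOrthogonal_of_isShift D hy x.2⟩, hy⟩
  exists_cone {x y} f := by
    obtain ⟨c, i, p, j, s, h⟩ := E.exists_cone f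
    refine ⟨⟨c, D.rightOrthogonal.ext_of_isTriangulatedClosed₃ _ (E.distinguished f i p j s h)
      x.2 y.2⟩, i, p, j, s, ⟨h.p_j, h.s_i, h.p_i, h.s_j, h.total, h.d_j⟩⟩
  distinguished {x y c} f i p j s h := by
    -- The inclusion undoes the transport of degree-zero morphisms to the subcategory. Hence it
    -- carries the triangle in question to the distinguished one of `E`, with equal components, and
    -- it detects distinguished triangles.
    have key : ∀ {x y : D.rightOrthogonal.FullSubcategory} (g : ShiftedHom x.obj y.obj (0 : ℤ)),
        D.rightOrthogonal.ι.map ((ShiftedHom.homEquiv (0 : ℤ) rfl).symm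
          ((shiftedHomEquiv (k := k) D.rightOrthogonal x y 0).symm g)) =
        (ShiftedHom.homEquiv (0 : ℤ) rfl).symm g := by
      intro x y g
      obtain ⟨g, rfl⟩ := (shiftedHomEquiv (k := k) D.rightOrthogonal x y 0).surjective g
      obtain ⟨g, rfl⟩ := (ShiftedHom.homEquiv (0 : ℤ) rfl).surjective g
      rw [LinearEquiv.symm_apply_apply, Equiv.symm_apply_apply, Equiv.eq_symm_apply]
      exact (ShiftedHom.map_mk₀ _ rfl g _).symm
    have h₁ := (shiftedHomEquiv (k := k) D.rightOrthogonal ⟨E.obj c.1, c.2⟩ ⟨E.obj x.1, x.2⟩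
      1).apply_symm_apply (E.map (x := c.1) (y := x.1) 1 p)
    have hE := E.distinguished f i p j s ⟨h.p_j, h.s_i, h.p_i, h.s_j, h.total, h.d_j⟩
    refine (D.rightOrthogonal.ι.map_distinguished_iff _).1 ?_
    refine isomorphic_distinguished _ hE _ (eqToIso ?_)
    have hmk : ∀ {X Y Z : T} {f f' : X ⟶ Y} {g g' : Y ⟶ Z} {h h' : Z ⟶ X⟦(1 : ℤ)⟧},
        f = f' → g = g' → h = h' → Triangle.mk f g h = Triangle.mk f' g' h' := by
      rintro _ _ _ _ _ _ _ _ _ rfl rfl rfl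
      rfl
    exact hmk (key _) (key _) h₁

end Restrict

end Enhancement

/-- The right orthogonal of a subcategory admitting reflections and coreflections inherits
saturatedness, provided that the ambient category has a Serre functor. -/
lemma IsSaturated.rightOrthogonal {k : Type w} [Field k] {T : Type u} [Category.{v} T]
    [Preadditive T] [Linear k T] [HasZeroObject T] [HasShift T ℤ]
    [∀ n : ℤ, (shiftFunctor T n).Additive] [Pretriangulated T] [IsTriangulated T]
    (hT : IsSaturated k T) (S : SerreFunctor k T) {D : ObjectProperty T} [D.IsTriangulated]
    (hr : HasReflections D) (hc : HasCoreflections D) :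
    IsSaturated k D.rightOrthogonal.FullSubcategory := by
  obtain ⟨hT, E, hsmooth, hproper⟩ := hT
  refine ⟨isIdempotentComplete_rightOrthogonal hT D, E.restrict D,
    -- Coreflections approximate the contravariant variable and need the Serre functor; reflections
    -- approximate the covariant one and do not.
    hsmooth.full
      (DGEnhancement.exists_quasiIso_postcomp (exists_rightOrthogonal_coreflection S hc))
      (DGEnhancement.exists_quasiIso_precomp fun Z => ?_), hproper.full _⟩
  obtain ⟨r, c, hc, hr⟩ := hr Z
  exact ⟨r, hr, c, fun G hG => bijective_precomp_of_trW hc hG⟩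

end ResidualCategory

theorem mainTheorem4 (k : Type w) [Field k]
    (T : Type u) [Category.{v} T] [Preadditive T] [Linear k T] [HasZeroObject T]
    [HasShift T ℤ] [∀ n : ℤ, (shiftFunctor T n).Additive] [∀ n : ℤ, (shiftFunctor T n).Linear k]
    [Pretriangulated T] [IsTriangulated T] (hT : IsSaturated k T)
    (τ : T ⥤ T) (m : ℕ) (hτ : IsPolarization k τ m)
    (a : ObjectProperty T) (ha : IsPrimitive τ m a) :
    IsSaturated k (residual τ m a).FullSubcategory ∧
      haveI := ha.isAdmissible
      ∃ h : ∀ X : (residual τ m a).FullSubcategory,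
          residual τ m a (((residual τ m a).ι ⋙ τ ⋙ leftMutation a).obj X),
        IsPolarization k
          ((residual τ m a).lift ((residual τ m a).ι ⋙ τ ⋙ leftMutation a) h) m := by
  obtain ⟨hm, ⟨hequiv, hlin, hcomm, htri⟩, S, s, ⟨σ⟩⟩ := hτ
  have := ha.isAdmissible
  exact ⟨hT.rightOrthogonal S ha.hasReflections ha.hasCoreflections,
    fun X => ha.residual_leftMutation X.property, ha.isPolarization _ S s σ hm hlin⟩
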